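/- Let $V=\{0,\dots,n-1\}$ be a universe of $n$ elements with an unknown partition $\mathcal P=\{P_1,\dots,P_k\}$ into nonempty parts. A rank query takes a set $S\subseteq V$ and returns $\mathrm{rank}(S)=\sum_{i=1}^k \min(|S\cap P_i|,1)$, the number of parts that $S$ meets. There is a deterministic polynomial-time algorithm that learns $\mathcal P$ with $O(n)$ rank queries. Precisely: there are a single deterministic program with oracle access (a random access machine with registers and arrays of natural numbers, whose unit-cost operations are addition, truncated subtraction, integer division, remainder, comparison and memory access; there is no multiplication), a constant $C$ and a polynomial $T$ such that for every $n\ge 0$ and every partition $\mathcal P$ of $V$, the program, given only $n$ and access to rank queries for $\mathcal P$ (each query may depend on the earlier answers, and is counted as $n+1$ steps), halts after at most $T(n)$ steps, having made at most $C\,n$ rank queries, and outputs labels $\ell(0),\dots,\ell(n-1)\in\mathbb N$ such that $\ell(u)=\ell(v)$ if and only if $u$ and $v$ lie in the same part of $\mathcal P$. -/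

import Mathlib

namespace RankQuery

/-- The rank of a set `S` for the partition `P`: each part contributes `min(|S ∩ p|, 1)`,
so this is the number of parts that `S` meets. -/
def rank {n : ℕ} (P : Finpartition (Finset.univ : Finset (Fin n))) (S : Finset (Fin n)) : ℕ :=
  ∑ p ∈ P.parts, min (S ∩ p).card 1

/-! ### The machine model

Random access machines with an oracle, written as structured programs.  A machine has registers
and arrays, all of whose entries are natural numbers.  Every arithmetic operation, comparison,
memory access and assignment takes one step.  There is no multiplication among the operations, so
that after `t` steps from input `n` every stored number has `O(t + log n)` bits; hence polynomially
many steps here are polynomial time on a Turing machine as well. -/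

/-- Binary operations; `sub` is truncated, comparisons return `1` (true) or `0` (false). -/
inductive Op where
  | add
  | sub
  | div
  | mod
  | lt
  | eq

/-- The value of a binary operation. -/
def Op.eval : Op → ℕ → ℕ → ℕ
  | .add, a, b => a + b
  | .sub, a, b => a - b
  | .div, a, b => a / b
  | .mod, a, b => a % b
  | .lt, a, b => if a < b then 1 else 0
  | .eq, a, b => if a = b then 1 else 0

/-- Expressions: constants, the register number `x`, the entry of the array number `a` at a
computed index, and operations. -/
inductive Expr where
  | const (k : ℕ)
  | reg (x : ℕ)
  | get (a : ℕ) (i : Expr)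
  | op (o : Op) (e f : Expr)

/-- The contents of the memory: `reg x` is the content of register `x`, and `arr a i` is the
entry of array `a` at index `i`. -/
structure Store where
  reg : ℕ → ℕ
  arr : ℕ → ℕ → ℕ

/-- Overwrite register `x`. -/
def Store.setReg (s : Store) (x v : ℕ) : Store where
  reg := Function.update s.reg x v
  arr := s.arr

/-- Overwrite the entry of array `a` at index `i`. -/
def Store.setArr (s : Store) (a i v : ℕ) : Store where
  reg := s.reg
  arr := Function.update s.arr a (Function.update (s.arr a) i v)

/-- The initial memory on a universe of `n` elements: register `0` holds `n`, all else is `0`. -/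
def Store.init (n : ℕ) : Store where
  reg := Function.update (fun _ => 0) 0 n
  arr := fun _ _ => 0

/-- The value of an expression. -/
def Expr.eval (s : Store) : Expr → ℕ
  | .const k => k
  | .reg x => s.reg x
  | .get a i => s.arr a (i.eval s)
  | .op o e f => o.eval (e.eval s) (f.eval s)

/-- The number of steps needed to evaluate an expression: one for each of its nodes. -/
def Expr.cost : Expr → ℕ
  | .const _ => 1
  | .reg _ => 1
  | .get _ i => i.cost + 1
  | .op _ e f => e.cost + f.cost + 1

/-- Programs. The test of a conditional or of a loop succeeds if its value is not `0`. -/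
inductive Prog where
  | skip
  /-- Write the value of `e` to register `x`. -/
  | assign (x : ℕ) (e : Expr)
  /-- Write the value of `e` to array `a` at the index given by `i`. -/
  | store (a : ℕ) (i e : Expr)
  /-- Ask the oracle about the set whose indicator vector is in array `a`; write the answer to
  register `x`. -/
  | query (x a : ℕ)
  | seq (c d : Prog)
  | ite (e : Expr) (c d : Prog)
  | loop (e : Expr) (c : Prog)

/-- The set of elements `v` of the universe with a nonzero entry at index `v` of array `a`. -/
def Store.set (s : Store) (n a : ℕ) : Finset (Fin n) :=
  Finset.univ.filter fun v => s.arr a v ≠ 0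

/-- `Exec oracle c s t q s'`: with access to `oracle`, the program `c` started in memory `s` halts
in memory `s'`, after `t` steps and with `q` oracle queries.  A query takes `n + 1` steps, as the
oracle reads `n` array entries. -/
inductive Exec {n : ℕ} (oracle : Finset (Fin n) → ℕ) : Prog → Store → ℕ → ℕ → Store → Prop where
  | skip (s : Store) : Exec oracle .skip s 1 0 s
  | assign (s : Store) (x : ℕ) (e : Expr) :
      Exec oracle (.assign x e) s (e.cost + 1) 0 (s.setReg x (e.eval s))
  | store (s : Store) (a : ℕ) (i e : Expr) :
      Exec oracle (.store a i e) s (i.cost + e.cost + 1) 0 (s.setArr a (i.eval s) (e.eval s))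
  | query (s : Store) (x a : ℕ) :
      Exec oracle (.query x a) s (n + 1) 1 (s.setReg x (oracle (s.set n a)))
  | seq {c d : Prog} {s₁ s₂ s₃ : Store} {t₁ t₂ q₁ q₂ : ℕ} :
      Exec oracle c s₁ t₁ q₁ s₂ → Exec oracle d s₂ t₂ q₂ s₃ →
      Exec oracle (.seq c d) s₁ (t₁ + t₂) (q₁ + q₂) s₃
  | ite_true {e : Expr} {c d : Prog} {s s' : Store} {t q : ℕ} :
      e.eval s ≠ 0 → Exec oracle c s t q s' →
      Exec oracle (.ite e c d) s (e.cost + 1 + t) q s'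
  | ite_false {e : Expr} {c d : Prog} {s s' : Store} {t q : ℕ} :
      e.eval s = 0 → Exec oracle d s t q s' →
      Exec oracle (.ite e c d) s (e.cost + 1 + t) q s'
  | loop_done {e : Expr} {c : Prog} {s : Store} :
      e.eval s = 0 → Exec oracle (.loop e c) s (e.cost + 1) 0 s
  | loop_step {e : Expr} {c : Prog} {s₁ s₂ s₃ : Store} {t₁ t₂ q₁ q₂ : ℕ} :
      e.eval s₁ ≠ 0 → Exec oracle c s₁ t₁ q₁ s₂ → Exec oracle (.loop e c) s₂ t₂ q₂ s₃ →
      Exec oracle (.loop e c) s₁ (e.cost + 1 + t₁ + t₂) (q₁ + q₂) s₃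

/-- Programs are deterministic: the run from a given memory is unique. -/
theorem Exec.deterministic {n : ℕ} {oracle : Finset (Fin n) → ℕ} {c : Prog} {s s₁ s₂ : Store}
    {t₁ t₂ q₁ q₂ : ℕ} (h₁ : Exec oracle c s t₁ q₁ s₁) (h₂ : Exec oracle c s t₂ q₂ s₂) :
    t₁ = t₂ ∧ q₁ = q₂ ∧ s₁ = s₂ := by
  induction h₁ generalizing t₂ q₂ s₂ with
  | skip => cases h₂; simp
  | assign => cases h₂; simp
  | store => cases h₂; simp
  | query => cases h₂; simp
  | seq _ _ ih₁ ih₂ =>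
    cases h₂ with
    | seq a b =>
      obtain ⟨rfl, rfl, rfl⟩ := ih₁ a
      obtain ⟨rfl, rfl, rfl⟩ := ih₂ b
      simp
  | ite_true he _ ih =>
    cases h₂ with
    | ite_true _ a => obtain ⟨rfl, rfl, rfl⟩ := ih a; simp
    | ite_false h _ => exact absurd h he
  | ite_false he _ ih =>
    cases h₂ with
    | ite_true h _ => exact absurd he h
    | ite_false _ a => obtain ⟨rfl, rfl, rfl⟩ := ih a; simp
  | loop_done he =>
    cases h₂ with
    | loop_done => simp
    | loop_step h => exact absurd he h
  | loop_step he _ _ ih₁ ih₂ =>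
    cases h₂ with
    | loop_done h => exact absurd h he
    | loop_step _ a b =>
      obtain ⟨rfl, rfl, rfl⟩ := ih₁ a
      obtain ⟨rfl, rfl, rfl⟩ := ih₂ b
      simp

/-- The memory `s` holds the partition `P` in array `0`: two elements of the universe carry the
same label there if and only if they lie in a common part. -/
def Describes {n : ℕ} (s : Store) (P : Finpartition (Finset.univ : Finset (Fin n))) : Prop :=
  ∀ u v : Fin n, s.arr 0 u = s.arr 0 v ↔ ∃ p ∈ P.parts, u ∈ p ∧ v ∈ p

end RankQuery

namespace RankQuery

/-! ### Programs with bounded loops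

Commands are programs all of whose loops are counting loops. They have a total denotational
semantics, and their running time is polynomial for syntactic reasons. -/

/-! Every element carries as its label a representative of its class, and the representatives inside
each block of `b` consecutive elements lie in different classes. A round passes from blocks of
length `b` to superblocks of length `2 ^ (4 * k)`: inside a superblock, each block in turn is
compared with the blocks before it. The representatives in the current block are the "coins", those
in the earlier blocks the "targets"; a coin has at most one partner among the targets.

If the elements of `T` lie in distinct classes, then rank(U ∪ T) = rank(U) + |T| - h(T), where h(T)
counts the elements of `T` whose class meets `U`. Hence two queries, with U ∪ T₊ and U ∪ T₋, reveal
h(T₊) - h(T₋): a weighing with signs of coins of weight 0 or 1 (`signed_weighing`). The Cantor–Mills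
matrix determines `k * 2 ^ (k - 1)` such weights from `2 ^ k` weighings (`form_succ`,
`form_decode`), so `m` coins cost about 4m/k queries (`weighCmd_spec`, `mul_weighCost_le`). One run
finds the coins that have a partner; for these alone, `4 * k` further runs, each with the targets
restricted to those with a given bit set, spell out the partner's position in the superblock
(`bitsCmd_spec`).

Amortisation: finding the partner of a coin costs about 16 queries, but that coin then ceases to be
a representative (`merge_step`), so this sums to 16n. Everything else in a round costs at most
48n/k, as long as k²2^k ≤ 2b absorbs the rounding (`blocksCmd_spec`). Since `k` doubles every round,
these terms sum to at most 96n, which gives 112n in all (`learnCmd_spec`).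

The time bound is separate: all loops are counting loops cut off at `4 * n + 8` rounds, so a
polynomial bound follows from the syntax (`Cmd.exec`). -/

instance : Add Expr := ⟨.op .add⟩
instance : Sub Expr := ⟨.op .sub⟩
instance : Div Expr := ⟨.op .div⟩
instance : Mod Expr := ⟨.op .mod⟩
instance (k : ℕ) : OfNat Expr k := ⟨.const k⟩

/-- The test `e < f`. -/
def Expr.lt (e f : Expr) : Expr := .op .lt e f

/-- The test `e = f`. -/
def Expr.eq (e f : Expr) : Expr := .op .eq e f

/-- The conjunction of two tests with values in `{0, 1}`. -/
def Expr.and (e f : Expr) : Expr := .op .lt (.const 1) (.op .add e f)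

section eval
variable (s : Store) (e f : Expr)

@[simp] theorem Expr.eval_add : (e + f).eval s = e.eval s + f.eval s := (rfl)
@[simp] theorem Expr.eval_sub : (e - f).eval s = e.eval s - f.eval s := (rfl)
@[simp] theorem Expr.eval_div : (e / f).eval s = e.eval s / f.eval s := (rfl)
@[simp] theorem Expr.eval_mod : (e % f).eval s = e.eval s % f.eval s := (rfl)
@[simp] theorem Expr.eval_ofNat (k : ℕ) : (ofNat(k) : Expr).eval s = OfNat.ofNat k := (rfl)
@[simp] theorem Expr.eval_zero : (0 : Expr).eval s = 0 := (rfl)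
@[simp] theorem Expr.eval_one : (1 : Expr).eval s = 1 := (rfl)
@[simp] theorem Expr.eval_reg (x : ℕ) : (Expr.reg x).eval s = s.reg x := (rfl)
@[simp] theorem Expr.eval_get (a : ℕ) : (Expr.get a e).eval s = s.arr a (e.eval s) := (rfl)
@[simp] theorem Expr.eval_lt : (e.lt f).eval s = if e.eval s < f.eval s then 1 else 0 := (rfl)
@[simp] theorem Expr.eval_eq : (e.eq f).eval s = if e.eval s = f.eval s then 1 else 0 := (rfl)
@[simp] theorem Expr.eval_and :
    (e.and f).eval s = if 1 < e.eval s + f.eval s then 1 else 0 := (rfl)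

end eval

@[simp] theorem one_lt_ite_add_ite (p q : Prop) [Decidable p] [Decidable q] :
    1 < (if p then 1 else 0) + (if q then 1 else 0) ↔ p ∧ q := by
  by_cases p <;> by_cases q <;> simp_all

section stores
variable (s : Store)

@[simp] theorem Store.setReg_reg (x v y : ℕ) :
    (s.setReg x v).reg y = if y = x then v else s.reg y := by
  simp [Store.setReg, Function.update_apply]
@[simp] theorem Store.setReg_arr (x v : ℕ) : (s.setReg x v).arr = s.arr := (rfl)
@[simp] theorem Store.setArr_reg (a i v : ℕ) : (s.setArr a i v).reg = s.reg := (rfl)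
@[simp] theorem Store.setArr_arr (a i v b : ℕ) :
    (s.setArr a i v).arr b = if b = a then Function.update (s.arr a) i v else s.arr b := by
  simp [Store.setArr, Function.update_apply]

end stores

/-- Commands: programs whose loops are counting loops. In `loop x y c`, the register `x` counts
from `0` up to the minimum of the registers `y` and `1`. -/
inductive Cmd where
  | skip
  | assign (x : ℕ) (e : Expr)
  | store (a : ℕ) (i e : Expr)
  | query (x a : ℕ)
  | seq (c d : Cmd)
  | ite (e : Expr) (c d : Cmd)
  | loop (x y : ℕ) (c : Cmd)

namespace Cmd

/-- `c.writes x`: the command `c` may write to the register `x`. -/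
def writes : Cmd → ℕ → Bool
  | skip, _ => false
  | assign x _, z => z == x
  | store _ _ _, _ => false
  | query x _, z => z == x
  | seq c d, z => c.writes z || d.writes z
  | ite _ c d, z => c.writes z || d.writes z
  | loop x _ c, z => z == x || c.writes z

/-- `c.stores a`: the command `c` may write to the array `a`. -/
def stores : Cmd → ℕ → Bool
  | skip, _ => false
  | assign _ _, _ => false
  | store a _ _, z => z == a
  | query _ _, _ => false
  | seq c d, z => c.stores z || d.stores z
  | ite _ c d, z => c.stores z || d.stores z
  | loop _ _ c, z => c.stores z

/-- Loop bodies write neither to their counters nor to their bounds. -/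
def ok : Cmd → Bool
  | seq c d => c.ok && d.ok
  | ite _ c d => c.ok && d.ok
  | loop x y c => c.ok && !c.writes x && !c.writes y && !c.writes 1 && !(x == y) && !(x == 1)
  | _ => true

/-- `c.asks`: the command `c` contains a query. -/
def asks : Cmd → Bool
  | query _ _ => true
  | seq c d => c.asks || d.asks
  | ite _ c d => c.asks || d.asks
  | loop _ _ c => c.asks
  | _ => false

/-- The program of a command. -/
def prog : Cmd → Prog
  | skip => .skip
  | assign x e => .assign x e
  | store a i e => .store a i e
  | query x a => .query x a
  | seq c d => .seq c.prog d.prog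
  | ite e c d => .ite e c.prog d.prog
  | loop x y c => .seq (.assign x 0) (.loop ((Expr.reg x).lt (.reg y - (.reg y - .reg 1)))
      (.seq c.prog (.assign x (.reg x + 1))))

variable {n : ℕ} (o : Finset (Fin n) → ℕ)

/-- The memory after the first `i` rounds of a loop with counter `x`, if `f` is the action of its
body. -/
def iter (f : Store → Store) (x : ℕ) (s : Store) : ℕ → Store
  | 0 => s
  | i + 1 => f ((iter f x s i).setReg x i)

/-- The memory after the execution of a command. -/
def run : Cmd → Store → Store
  | skip, s => s
  | assign x e, s => s.setReg x (e.eval s)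
  | store a i e, s => s.setArr a (i.eval s) (e.eval s)
  | query x a, s => s.setReg x (o (s.set n a))
  | seq c d, s => d.run (c.run s)
  | ite e c d, s => if e.eval s ≠ 0 then c.run s else d.run s
  | loop x y c, s =>
      (iter c.run x s (min (s.reg y) (s.reg 1))).setReg x (min (s.reg y) (s.reg 1))

/-- The number of queries in the execution of a command. -/
def cost : Cmd → Store → ℕ
  | query _ _, _ => 1
  | seq c d, s => c.cost s + d.cost (c.run o s)
  | ite e c d, s => if e.eval s ≠ 0 then c.cost s else d.cost s
  | loop x y c, s => ∑ i ∈ Finset.range (min (s.reg y) (s.reg 1)),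
      c.cost ((iter (c.run o) x s i).setReg x i)
  | _, _ => 0

@[simp] theorem run_skip (s : Store) : skip.run o s = s := rfl
@[simp] theorem run_assign (s : Store) (x : ℕ) (e : Expr) :
    (assign x e).run o s = s.setReg x (e.eval s) := rfl
@[simp] theorem run_store (s : Store) (a : ℕ) (i e : Expr) :
    (store a i e).run o s = s.setArr a (i.eval s) (e.eval s) := rfl
@[simp] theorem run_query (s : Store) (x a : ℕ) :
    (query x a).run o s = s.setReg x (o (s.set n a)) := rfl
@[simp] theorem run_seq (s : Store) (c d : Cmd) :
    (seq c d).run o s = d.run o (c.run o s) := rfl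
@[simp] theorem run_ite (s : Store) (e : Expr) (c d : Cmd) :
    (ite e c d).run o s = if e.eval s ≠ 0 then c.run o s else d.run o s := rfl
@[simp] theorem cost_seq (s : Store) (c d : Cmd) :
    (seq c d).cost o s = c.cost o s + d.cost o (c.run o s) := rfl
@[simp] theorem cost_ite (s : Store) (e : Expr) (c d : Cmd) :
    (ite e c d).cost o s = if e.eval s ≠ 0 then c.cost o s else d.cost o s := rfl
@[simp] theorem cost_query (s : Store) (x a : ℕ) : (query x a).cost o s = 1 := rfl

theorem iter_reg {f : Store → Store} {x z : ℕ} (hz : z ≠ x)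
    (hf : ∀ s, (f s).reg z = s.reg z) (s : Store) (i : ℕ) :
    (iter f x s i).reg z = s.reg z := by
  induction i with
  | zero => rfl
  | succ i ih => simp [iter, hf, hz, ih]

theorem iter_arr {f : Store → Store} {x a : ℕ}
    (hf : ∀ s, (f s).arr a = s.arr a) (s : Store) (i : ℕ) :
    (iter f x s i).arr a = s.arr a := by
  induction i with
  | zero => rfl
  | succ i ih => simp [iter, hf, ih]

theorem run_reg {c : Cmd} {z : ℕ} (h : c.writes z = false) (s : Store) :
    (c.run o s).reg z = s.reg z := by
  induction c generalizing s with
  | skip => rfl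
  | store => rfl
  | assign x e => simp_all [writes]
  | query x a => simp_all [writes]
  | seq c d ihc ihd => simp_all [writes]
  | ite e c d ihc ihd => simp_all [writes]; split <;> simp_all
  | loop x y c ih =>
    simp only [writes, Bool.or_eq_false_iff, beq_eq_false_iff_ne] at h
    simp [run, h.1, iter_reg h.1 (ih h.2)]

theorem run_arr {c : Cmd} {a : ℕ} (h : c.stores a = false) (s : Store) :
    (c.run o s).arr a = s.arr a := by
  induction c generalizing s with
  | skip => rfl
  | assign => rfl
  | query => rfl
  | store b i e => simp_all [stores]
  | seq c d ihc ihd => simp_all [stores]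
  | ite e c d ihc ihd => simp_all [stores]; split <;> simp_all
  | loop x y c ih => simp [run, iter_arr (ih h)]

theorem cost_eq_zero {c : Cmd} (h : c.asks = false) (s : Store) : c.cost o s = 0 := by
  induction c generalizing s with
  | skip => rfl
  | assign => rfl
  | query => simp [asks] at h
  | store b i e => rfl
  | seq c d ihc ihd => simp_all [asks]
  | ite e c d ihc ihd => simp_all [asks]
  | loop x y c ih => simp [cost, ih h]

/-- A loop keeps its invariants; queries are counted. -/
theorem loop_rule_cost {x y : ℕ} {c : Cmd} {s : Store} {b : ℕ} (hy : s.reg y = b)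
    (hb : b ≤ s.reg 1) (I : ℕ → Store → ℕ → Prop) (h0 : I 0 s 0)
    (hs : ∀ i st q, i < b → (∀ z, c.writes z = false → z ≠ x → st.reg z = s.reg z) →
      (∀ a, c.stores a = false → st.arr a = s.arr a) → I i st q →
      I (i + 1) (c.run o (st.setReg x i)) (q + c.cost o (st.setReg x i))) :
    ∃ st, (loop x y c).run o s = st.setReg x b ∧ I b st ((loop x y c).cost o s) := by
  refine ⟨iter (c.run o) x s b, by simp [run, hy, hb], ?_⟩
  have : ∀ i ≤ b, I i (iter (c.run o) x s i)
      (∑ j ∈ Finset.range i, c.cost o ((iter (c.run o) x s j).setReg x j)) := by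
    intro i hi
    induction i with
    | zero => simpa [iter] using h0
    | succ i ih =>
      rw [Finset.sum_range_succ]
      exact hs i _ _ hi (fun z hz hx => iter_reg hx (run_reg o hz) s i)
        (fun a ha => iter_arr (run_arr o ha) s i) (ih (by omega))
  simpa [cost, hy, hb] using this b le_rfl

/-- A loop keeps its invariants. -/
theorem loop_rule {x y : ℕ} {c : Cmd} {s : Store} {b : ℕ} (hy : s.reg y = b)
    (hb : b ≤ s.reg 1) (I : ℕ → Store → Prop) (h0 : I 0 s)
    (hs : ∀ i st, i < b → (∀ z, c.writes z = false → z ≠ x → st.reg z = s.reg z) →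
      (∀ a, c.stores a = false → st.arr a = s.arr a) → I i st →
      I (i + 1) (c.run o (st.setReg x i))) :
    ∃ st, (loop x y c).run o s = st.setReg x b ∧ I b st := by
  obtain ⟨st, h, h'⟩ := loop_rule_cost o hy hb (fun i st _ => I i st) h0
    (fun i st _ hi h1 h2 h3 => hs i st hi h1 h2 h3)
  exact ⟨st, h, h'⟩

/-- A polynomial bound in `n` for the number of steps, for the loop limit `4 * n + 8`. -/
noncomputable def time : Cmd → Polynomial ℕ
  | skip => 1
  | assign _ e => (e.cost + 1 : ℕ)
  | store _ i e => (i.cost + e.cost + 1 : ℕ)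
  | query _ _ => .X + 1
  | seq c d => c.time + d.time
  | ite e c d => (e.cost + 1 : ℕ) + (c.time + d.time)
  | loop _ _ c => 2 + (4 * .X + 8) * (12 + c.time) + 8

/-- As `ok` protects counters, bounds and the limit register from the loop bodies, each loop runs
exactly the number of rounds fixed at its start, which is at most `4 * n + 8`. Induction on the
syntax then multiplies and adds polynomials. -/
theorem exec {c : Cmd} (hc : c.ok = true) (hw : c.writes 1 = false) {s : Store}
    (hs : s.reg 1 = 4 * n + 8) :
    ∃ t, t ≤ c.time.eval n ∧ Exec o c.prog s t (c.cost o s) (c.run o s) := by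
  induction c generalizing s with
  | skip => exact ⟨1, by simp [time], .skip s⟩
  | assign x e => exact ⟨_, by simp [time], .assign s x e⟩
  | store a i e => exact ⟨_, by simp [time], .store s a i e⟩
  | query x a => exact ⟨_, by simp [time], .query s x a⟩
  | seq c d ihc ihd =>
    simp only [ok, Bool.and_eq_true, writes, Bool.or_eq_false_iff] at hc hw
    obtain ⟨t₁, h₁, e₁⟩ := ihc hc.1 hw.1 hs
    obtain ⟨t₂, h₂, e₂⟩ := ihd hc.2 hw.2 (s := c.run o s) (by rw [run_reg o hw.1, hs])
    exact ⟨_, by simpa [time] using add_le_add h₁ h₂, .seq e₁ e₂⟩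
  | ite e c d ihc ihd =>
    simp only [ok, Bool.and_eq_true, writes, Bool.or_eq_false_iff] at hc hw
    by_cases he : e.eval s = 0
    · obtain ⟨t, h, ex⟩ := ihd hc.2 hw.2 hs
      refine ⟨_, ?_, by simpa [prog, he] using Exec.ite_false he ex⟩
      simp [time]; omega
    · obtain ⟨t, h, ex⟩ := ihc hc.1 hw.1 hs
      refine ⟨_, ?_, by simpa [prog, he] using Exec.ite_true he ex⟩
      simp [time]; omega
  | loop x y c ih =>
    simp only [ok, Bool.and_eq_true, writes, Bool.or_eq_false_iff, Bool.not_eq_true',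
      beq_eq_false_iff_ne] at hc hw
    obtain ⟨⟨⟨⟨⟨hc, hx⟩, hy⟩, h1⟩, hxy⟩, hx1⟩ := hc
    set b := min (s.reg y) (s.reg 1) with hb
    set W := Prog.loop ((Expr.reg x).lt (.reg y - (.reg y - .reg 1)))
      (.seq c.prog (.assign x (.reg x + 1))) with hW
    have eval_test : ∀ i ≤ b,
        ((Expr.reg x).lt (.reg y - (.reg y - .reg 1))).eval
          ((iter (c.run o) x s i).setReg x i) = if i < b then 1 else 0 := by
      intro i hi
      have ey : (iter (c.run o) x s i).reg y = s.reg y := iter_reg hxy.symm (run_reg o hy) s i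
      have e1 : (iter (c.run o) x s i).reg 1 = s.reg 1 := iter_reg hx1.symm (run_reg o h1) s i
      -- With truncated subtraction, y - (y - z) is the minimum of y and z.
      have : s.reg y - (s.reg y - s.reg 1) = b := by omega
      simp [ey, e1, this, hxy.symm, hx1.symm]
    -- Induction on the number `d` of rounds still to come, because `Exec.loop_step` puts a round in
    -- front of a run. A failing test takes 7 + 1 = 8 steps; a round takes 8 for the test, 3 + 1 for
    -- the increment, and the body.
    have main : ∀ d ≤ b, ∃ t, t ≤ 8 + d * (12 + c.time.eval n) ∧
        Exec o W ((iter (c.run o) x s (b - d)).setReg x (b - d)) t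
          (∑ i ∈ Finset.Ico (b - d) b, c.cost o ((iter (c.run o) x s i).setReg x i))
          ((iter (c.run o) x s b).setReg x b) := by
      intro d hd
      induction d with
      | zero =>
        refine ⟨8, by simp, ?_⟩
        simp only [Nat.sub_zero, Finset.Ico_self, Finset.sum_empty]
        exact Exec.loop_done ((eval_test b le_rfl).trans (by simp))
      | succ d ihd =>
        obtain ⟨t, ht, ex⟩ := ihd (by omega)
        have hlt : b - (d + 1) < b := by omega
        obtain ⟨t', ht', ex'⟩ := ih hc h1 (s := (iter (c.run o) x s (b - (d + 1))).setReg x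
          (b - (d + 1))) (by
            rw [Store.setReg_reg, if_neg hx1.symm, iter_reg hx1.symm (run_reg o h1), hs])
        have e1 : b - d = b - (d + 1) + 1 := by omega
        have ea : Exec o _ _ _ _ _ := .assign (c.run o ((iter (c.run o) x s (b - (d + 1))).setReg x
          (b - (d + 1)))) x (.reg x + 1)
        have key : (c.run o ((iter (c.run o) x s (b - (d + 1))).setReg x (b - (d + 1)))).setReg x
            ((Expr.reg x + 1).eval (c.run o ((iter (c.run o) x s (b - (d + 1))).setReg x
            (b - (d + 1))))) = (iter (c.run o) x s (b - d)).setReg x (b - d) := by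
          rw [e1]; simp [iter, run_reg o hx]
        rw [key] at ea
        have := Exec.loop_step (by rw [eval_test _ hlt.le, if_pos hlt]; exact one_ne_zero)
          (Exec.seq ex' ea) ex
        refine ⟨_, ?_, by
          rw [← Finset.insert_Ico_add_one_left_eq_Ico hlt, ← e1, Finset.sum_insert (by simp; omega)]
          exact this⟩
        have c1 : ((Expr.reg x).lt (.reg y - (.reg y - .reg 1))).cost = 7 := rfl
        have c2 : (Expr.reg x + 1 : Expr).cost = 3 := rfl
        rw [c1, c2, Nat.succ_mul]
        omega
    obtain ⟨t, ht, ex⟩ := main b le_rfl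
    rw [Nat.sub_self] at ex
    have e0 : Exec o _ _ _ _ _ := .assign s x 0
    have e1 := Exec.seq e0 ex
    rw [zero_add, Nat.Ico_zero_eq_range] at e1
    refine ⟨_, ?_, e1⟩
    have hb' : b ≤ 4 * n + 8 := by omega
    have := Nat.mul_le_mul_right (12 + c.time.eval n) hb'
    have c0 : (0 : Expr).cost = 1 := rfl
    simp only [time, Polynomial.eval_add, Polynomial.eval_mul, Polynomial.eval_ofNat,
      Polynomial.eval_X, c0]
    omega

end Cmd

end RankQuery

namespace RankQuery

/-! ### Coin weighing

The weighing matrix of Cantor and Mills. A coin sits in a slot `(l, i)`, where bit number `l` of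
`i` is zero. -/

/-- The sign of the coin in slot `(l, i)` in the weighing number `r`, taking into account the bits
below `b`; the sign `-1` is encoded as `2`. -/
def sgn (l i r : ℕ) : ℕ → ℕ
  | 0 => if r % 2 ^ (l + 1) = i % 2 ^ (l + 1) then 1 else 0
  | b + 1 => if l < b ∧ 1 < r / 2 ^ b % 2 + i / 2 ^ b % 2 then (sgn l i r b + sgn l i r b) % 3
      else sgn l i r b

/-- The integer encoded by a sign. -/
def signVal (t : ℕ) : ℤ := if t = 1 then 1 else if t = 2 then -1 else 0

theorem neg_one_le_signVal (t : ℕ) : -1 ≤ signVal t := by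
  unfold signVal; split_ifs <;> norm_num

theorem sgn_lt_three (l i r b : ℕ) : sgn l i r b < 3 := by
  induction b with
  | zero => unfold sgn; split <;> norm_num
  | succ b ih => unfold sgn; split <;> omega

/-- Doubling modulo 3 swaps 1 and 2, so the machine can negate a sign without multiplication. -/
theorem signVal_double {t : ℕ} (ht : t < 3) : signVal ((t + t) % 3) = -signVal t := by
  interval_cases t <;> rfl

theorem sgn_of_le {l b : ℕ} (h : b ≤ l + 1) (i r : ℕ) :
    sgn l i r b = if r % 2 ^ (l + 1) = i % 2 ^ (l + 1) then 1 else 0 := by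
  induction b with
  | zero => rfl
  | succ b ih => rw [sgn, if_neg (by omega), ih (by omega)]

/-- Only the bits of the row below `b` have been used so far. Rows `r` and `r + 2 ^ b` therefore
carry the same sign until bit `b` enters. -/
theorem sgn_congr {l b r r' : ℕ} (i : ℕ) (hl : l < b) (h : r % 2 ^ b = r' % 2 ^ b) :
    sgn l i r b = sgn l i r' b := by
  have bits : ∀ m c, c < m → r % 2 ^ m = r' % 2 ^ m → r / 2 ^ c % 2 = r' / 2 ^ c % 2 := by
    intro m c hc hm
    have e : 2 ^ m = 2 ^ c * (2 * 2 ^ (m - c - 1)) := by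
      rw [← pow_succ', ← pow_add]; congr 1; omega
    have aux : ∀ t : ℕ, t / 2 ^ c % 2 = t % 2 ^ m / 2 ^ c % 2 := by
      intro t
      rw [e, Nat.mod_mul_right_div_self, Nat.mod_mul_right_mod]
    rw [aux r, aux r', hm]
  have low : r % 2 ^ (l + 1) = r' % 2 ^ (l + 1) := by
    have := congrArg (· % 2 ^ (l + 1)) h
    simpa [Nat.mod_mod_of_dvd _ (pow_dvd_pow 2 (Nat.succ_le_of_lt hl))] using this
  have main : ∀ c ≤ b, sgn l i r c = sgn l i r' c := by
    intro c hc
    induction c with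
    | zero => simp [sgn, low]
    | succ c ih => rw [sgn, sgn, ih (by omega), bits b c (by omega) h]
  exact main b le_rfl

/-- The coefficient of the coin in slot `(l, i)` in the linear form number `r` of stage `b`. At
the last stage, these forms are the weighings. -/
def coef (l i b r : ℕ) : ℤ := if r / 2 ^ b = i / 2 ^ b then signVal (sgn l i r b) else 0

theorem neg_one_le_coef (l i b r : ℕ) : -1 ≤ coef l i b r := by
  unfold coef; split_ifs
  · exact neg_one_le_signVal _
  · norm_num

theorem coef_new (i b r : ℕ) : coef b i (b + 1) r = if r = i then 1 else 0 := by
  unfold coef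
  rw [sgn_of_le le_rfl]
  by_cases h : r = i
  · simp [h, signVal]
  · rw [if_neg h]
    split_ifs with h1 h2
    · exact absurd (by rw [← Nat.div_add_mod r (2 ^ (b + 1)), h1, h2, Nat.div_add_mod]) h
    · simp [signVal]
    · rfl

/-- The Hadamard step (u, v) ↦ (u + v, u - v). Bit `b` of `i` decides which of the two forms
contains the coin; the sign flips exactly when this bit is set in both the slot and the row. -/
theorem coef_succ {l b r : ℕ} (i : ℕ) (hl : l < b) (hr : r / 2 ^ b % 2 = 0) :
    coef l i (b + 1) r = coef l i b r + coef l i b (r + 2 ^ b) ∧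
      coef l i (b + 1) (r + 2 ^ b) = coef l i b r - coef l i b (r + 2 ^ b) := by
  have hdiv : (r + 2 ^ b) / 2 ^ b = r / 2 ^ b + 1 := Nat.add_div_right r (by positivity)
  have hs : sgn l i (r + 2 ^ b) b = sgn l i r b := sgn_congr i hl (by simp)
  have h3 := sgn_lt_three l i r b
  simp only [coef, pow_succ, ← Nat.div_div_eq_div_mul, sgn, hdiv, hl, hs, true_and]
  have e1 : (r / 2 ^ b + 1) / 2 = r / 2 ^ b / 2 := by omega
  have e2 : (r / 2 ^ b + 1) % 2 = 1 := by omega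
  rw [e1, e2, hr]
  rcases Nat.mod_two_eq_zero_or_one (i / 2 ^ b) with hi | hi <;> rw [hi]
  · by_cases h : r / 2 ^ b / 2 = i / 2 ^ b / 2
    · have h1 : r / 2 ^ b = i / 2 ^ b := by omega
      have h2 : ¬ (r / 2 ^ b + 1 = i / 2 ^ b) := by omega
      simp [h1]
    · have h1 : ¬ (r / 2 ^ b = i / 2 ^ b) := by omega
      have h2 : ¬ (r / 2 ^ b + 1 = i / 2 ^ b) := by omega
      simp [h, h1, h2]
  · by_cases h : r / 2 ^ b / 2 = i / 2 ^ b / 2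
    · have h1 : ¬ (r / 2 ^ b = i / 2 ^ b) := by omega
      have h2 : r / 2 ^ b + 1 = i / 2 ^ b := by omega
      simp [h, h1, h2, signVal_double h3]
    · have h1 : ¬ (r / 2 ^ b = i / 2 ^ b) := by omega
      have h2 : ¬ (r / 2 ^ b + 1 = i / 2 ^ b) := by omega
      simp [h, h1, h2]

/-- The value of the linear form number `r` of stage `b` for coins `v ∈ Z` in slots `(l v, i v)`
with weights `x v`. -/
def form (Z : Finset ℕ) (l i x : ℕ → ℕ) (b r : ℕ) : ℤ :=
  ∑ v ∈ Z with l v < b, coef (l v) (i v) b r * x v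

/-- The total weight in slot `(b, r)`. -/
def slotSum (Z : Finset ℕ) (l i x : ℕ → ℕ) (b r : ℕ) : ℕ :=
  ∑ v ∈ Z with l v = b ∧ i v = r, x v

/-- The recursion that makes decoding possible. Coins of level below `b` follow the Hadamard step,
and those of level above `b` are still absent. A coin of level `b` enters in the single row `i`; bit
`b` of `i` is zero, so it affects the sum but never the difference. -/
theorem form_succ {Z : Finset ℕ} {l i : ℕ → ℕ} (x : ℕ → ℕ) {b r : ℕ}
    (hi : ∀ v ∈ Z, i v / 2 ^ l v % 2 = 0) (hr : r / 2 ^ b % 2 = 0) :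
    form Z l i x (b + 1) r =
        form Z l i x b r + form Z l i x b (r + 2 ^ b) + slotSum Z l i x b r ∧
      form Z l i x (b + 1) (r + 2 ^ b) =
        form Z l i x b r - form Z l i x b (r + 2 ^ b) := by
  have hdiv : (r + 2 ^ b) / 2 ^ b = r / 2 ^ b + 1 := Nat.add_div_right r (by positivity)
  simp only [form, slotSum, Finset.sum_filter, Nat.cast_sum, ← Finset.sum_add_distrib,
    ← Finset.sum_sub_distrib, Nat.cast_ite, Nat.cast_zero]
  constructor
  · refine Finset.sum_congr rfl fun v hv => ?_
    rcases lt_trichotomy (l v) b with h | h | h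
    · rw [if_pos (by omega), if_pos h, if_pos h, if_neg (by omega), (coef_succ (i v) h hr).1]
      ring
    · subst h
      simp [coef_new, eq_comm]
    · simp [show ¬ l v < b + 1 by omega, show ¬ l v < b by omega, show l v ≠ b by omega]
  · refine Finset.sum_congr rfl fun v hv => ?_
    rcases lt_trichotomy (l v) b with h | h | h
    · rw [if_pos (by omega), if_pos h, if_pos h, (coef_succ (i v) h hr).2]
      ring
    · subst h
      have : r + 2 ^ l v ≠ i v := by
        intro he
        have := hi v hv
        rw [← he, hdiv] at this
        omega
      simp [coef_new, this]
    · simp [show ¬ l v < b + 1 by omega, show ¬ l v < b by omega]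

/-- Adding `n` makes all forms nonnegative, so they can be stored as natural numbers and truncated
subtraction is exact on them. -/
theorem neg_card_le_form (Z : Finset ℕ) (l i : ℕ → ℕ) {x : ℕ → ℕ} (hx : ∀ v, x v ≤ 1)
    (b r : ℕ) : -(Z.card : ℤ) ≤ form Z l i x b r := by
  have h1 : (Z.filter fun v => l v < b).card ≤ Z.card := Finset.card_filter_le _ _
  have h2 : ∑ v ∈ Z with l v < b, (-1 : ℤ) ≤ form Z l i x b r := by
    refine Finset.sum_le_sum fun v _ => ?_
    have h3 := neg_one_le_coef (l v) (i v) b r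
    have h4 := hx v
    interval_cases x v
    · simp
    · simpa using h3
  simp at h2
  omega

theorem slotSum_eq {Z : Finset ℕ} {l i x : ℕ → ℕ}
    (hinj : ∀ u ∈ Z, ∀ v ∈ Z, l u = l v → i u = i v → u = v) {v : ℕ} (hv : v ∈ Z) :
    slotSum Z l i x (l v) (i v) = x v := by
  have : (Z.filter fun u => l u = l v ∧ i u = i v) = {v} := by
    ext u
    simp only [Finset.mem_filter, Finset.mem_singleton]
    constructor
    · rintro ⟨h1, h2, h3⟩
      exact hinj u h1 v hv h2 h3
    · rintro rfl
      exact ⟨hv, rfl, rfl⟩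
  rw [slotSum, this, Finset.sum_singleton]

theorem slotSum_le_one {Z : Finset ℕ} {l i x : ℕ → ℕ} (hx : ∀ v, x v ≤ 1)
    (hinj : ∀ u ∈ Z, ∀ v ∈ Z, l u = l v → i u = i v → u = v) (b r : ℕ) :
    slotSum Z l i x b r ≤ 1 := by
  by_cases h : ∃ v ∈ Z, l v = b ∧ i v = r
  · obtain ⟨v, hv, rfl, rfl⟩ := h
    rw [slotSum_eq hinj hv]
    exact hx v
  · rw [slotSum, Finset.filter_false_of_mem (by simpa using h)]
    simp

/-- One step of the decoding, for the shifted values `y r = n + form r`. -/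
theorem form_decode {Z : Finset ℕ} {l i x y : ℕ → ℕ} {n b r : ℕ}
    (hi : ∀ v ∈ Z, i v / 2 ^ l v % 2 = 0) (hx : ∀ v, x v ≤ 1)
    (hinj : ∀ u ∈ Z, ∀ v ∈ Z, l u = l v → i u = i v → u = v) (hn : Z.card ≤ n)
    (hr : r / 2 ^ b % 2 = 0) (h1 : (y r : ℤ) = n + form Z l i x (b + 1) r)
    (h2 : (y (r + 2 ^ b) : ℤ) = n + form Z l i x (b + 1) (r + 2 ^ b)) :
    (((y r + y (r + 2 ^ b)) / 2 : ℕ) : ℤ) = n + form Z l i x b r ∧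
    (((y r + n + n - y (r + 2 ^ b)) / 2 : ℕ) : ℤ) = n + form Z l i x b (r + 2 ^ b) ∧
    (y r + y (r + 2 ^ b)) % 2 = slotSum Z l i x b r := by
  -- Sum and difference of the two rows of stage `b + 1` are twice a form of stage `b` plus the
  -- weight in slot `(b, r)`. This weight is 0 or 1, so it is the parity, and halving with rounding
  -- down discards it.
  obtain ⟨e1, e2⟩ := form_succ x hi hr
  have h3 := slotSum_le_one hx hinj b r
  have h4 := neg_card_le_form Z l i hx b r
  have h5 := neg_card_le_form Z l i hx b (r + 2 ^ b)
  omega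

/-! ### Rank queries as signed weighings -/

section rank
variable {α : Type*} [DecidableEq α] (cls : ℕ → α)

/-- An element of `T` either lies in a class already met by `U` or contributes a class of its own.
-/
theorem card_image_union {U T : Finset ℕ} (hT : Set.InjOn cls T) :
    ((U ∪ T).image cls).card =
      (U.image cls).card + (T.filter fun v => cls v ∉ U.image cls).card := by
  have : (U ∪ T).image cls =
      U.image cls ∪ (T.filter fun v => cls v ∉ U.image cls).image cls := by
    ext a
    simp only [Finset.mem_image, Finset.mem_union, Finset.mem_filter]
    constructor
    · rintro ⟨v, hv | hv, rfl⟩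
      · exact Or.inl ⟨v, hv, rfl⟩
      · by_cases h : ∃ u ∈ U, cls u = cls v
        · exact Or.inl h
        · exact Or.inr ⟨v, ⟨hv, h⟩, rfl⟩
    · rintro (⟨v, hv, rfl⟩ | ⟨v, hv, rfl⟩)
      · exact ⟨v, Or.inl hv, rfl⟩
      · exact ⟨v, Or.inr hv.1, rfl⟩
  have inj : Set.InjOn cls (T.filter fun v => cls v ∉ U.image cls) :=
    hT.mono (by intro v hv; exact (Finset.mem_filter.mp hv).1)
  rw [this, Finset.card_union_of_disjoint, Finset.card_image_of_injOn inj]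
  · rw [Finset.disjoint_left]
    intro a ha hb
    obtain ⟨v, hv, rfl⟩ := Finset.mem_image.mp hb
    exact (Finset.mem_filter.mp hv).2 ha

/-- Two rank queries give a signed weighing. -/
theorem signed_weighing {U Z : Finset ℕ} {n : ℕ} (hZ : Set.InjOn cls Z) (hn : Z.card ≤ n)
    (t : ℕ → ℕ) :
    (((n + (Z.filter fun v => t v = 1).card + ((U ∪ Z.filter fun v => t v = 2).image cls).card) -
      ((Z.filter fun v => t v = 2).card + ((U ∪ Z.filter fun v => t v = 1).image cls).card) : ℕ)
        : ℤ) =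
      n + ∑ v ∈ Z, signVal (t v) * (if cls v ∈ U.image cls then 1 else 0 : ℕ) := by
  have inj : ∀ c, Set.InjOn cls (Z.filter fun v => t v = c) := fun c =>
    hZ.mono (by intro v hv; exact (Finset.mem_filter.mp hv).1)
  have split : ∀ c, (Z.filter fun v => t v = c).card =
      ((Z.filter fun v => t v = c).filter fun v => cls v ∈ U.image cls).card +
      ((Z.filter fun v => t v = c).filter fun v => cls v ∉ U.image cls).card := fun c =>
    (Finset.card_filter_add_card_filter_not _).symm
  have sum : ∑ v ∈ Z, signVal (t v) * (if cls v ∈ U.image cls then 1 else 0 : ℕ) =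
      ((((Z.filter fun v => t v = 1).filter fun v => cls v ∈ U.image cls).card : ℕ) : ℤ) -
      ((((Z.filter fun v => t v = 2).filter fun v => cls v ∈ U.image cls).card : ℕ) : ℤ) := by
    simp only [Finset.card_filter, Finset.filter_filter, Nat.cast_sum,
      ← Finset.sum_sub_distrib]
    refine Finset.sum_congr rfl fun v _ => ?_
    unfold signVal
    split_ifs <;> simp_all
  -- The number of classes met by `U` occurs in both queries and cancels. The shift by `n` outweighs
  -- the coins of negative sign, so the subtraction is not truncated.
  have le : (Z.filter fun v => t v = 2).card ≤ Z.card := Finset.card_filter_le _ _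
  rw [card_image_union cls (inj 1), card_image_union cls (inj 2), sum]
  have s1 := split 1
  have s2 := split 2
  omega

end rank

end RankQuery

namespace RankQuery

/-! ### The weighing program

Registers and arrays of the program have names, which start with `r` and `a`, respectively. -/

notation "rN" => (0 : ℕ)
notation "rLimit" => (1 : ℕ)
notation "rRound" => (2 : ℕ)
notation "rDim" => (3 : ℕ)
notation "rBlock" => (4 : ℕ)
notation "rRows" => (5 : ℕ)
notation "rHalf" => (6 : ℕ)
notation "rCap" => (7 : ℕ)
notation "rBits" => (8 : ℕ)
notation "rSuper" => (9 : ℕ)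
notation "rPos" => (10 : ℕ)
notation "rBase" => (11 : ℕ)
notation "rBit" => (12 : ℕ)
notation "rNum" => (13 : ℕ)
notation "rChunks" => (14 : ℕ)
notation "rChunk" => (15 : ℕ)
notation "rRow" => (16 : ℕ)
notation "rElt" => (17 : ℕ)
notation "rLow" => (18 : ℕ)
notation "rSign" => (19 : ℕ)
notation "rPlus" => (20 : ℕ)
notation "rMinus" => (21 : ℕ)
notation "rAskPlus" => (22 : ℕ)
notation "rAskMinus" => (23 : ℕ)
notation "rPow" => (24 : ℕ)
notation "rTemp" => (25 : ℕ)
notation "rStage" => (26 : ℕ)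
notation "rStep" => (27 : ℕ)

notation "aLabel" => (0 : ℕ)
notation "aPow" => (1 : ℕ)
notation "aCoin" => (2 : ℕ)
notation "aTarget" => (3 : ℕ)
notation "aNum" => (4 : ℕ)
notation "aChunk" => (5 : ℕ)
notation "aLev" => (6 : ℕ)
notation "aSlot" => (7 : ℕ)
notation "aPlus" => (8 : ℕ)
notation "aMinus" => (9 : ℕ)
notation "aForm" => (10 : ℕ)
notation "aNext" => (11 : ℕ)
notation "aHit" => (12 : ℕ)
notation "aPartner" => (13 : ℕ)

/-- The entry of an array at the index given by a register. -/
def entry (a x : ℕ) : Expr := .get a (.reg x)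

@[simp] theorem eval_entry (s : Store) (a x : ℕ) : (entry a x).eval s = s.arr a (s.reg x) := (rfl)

open Cmd

/-- The parameters of the weighing program: the weighing matrix has `2 ^ k` rows. -/
structure Env (n k : ℕ) (s : Store) : Prop where
  size : s.reg rN = n
  limit : s.reg rLimit = 4 * n + 8
  dim : s.reg rDim = k
  rows : s.reg rRows = 2 ^ k
  half : s.reg rHalf = 2 ^ (k - 1)
  cap : s.reg rCap = k * 2 ^ (k - 1)
  pow : ∀ j < 4 * n + 8, s.arr aPow j = 2 ^ j

theorem Env.congr {n k : ℕ} {s s' : Store} (h : Env n k s)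
    (hr : ∀ x ∈ [rN, rLimit, rDim, rRows, rHalf, rCap], s'.reg x = s.reg x)
    (ha : s'.arr aPow = s.arr aPow) : Env n k s' := by
  simp at hr
  obtain ⟨h0, h1, h2, h3, h4, h5⟩ := hr
  exact ⟨by rw [h0, h.size], by rw [h1, h.limit], by rw [h2, h.dim], by rw [h3, h.rows],
    by rw [h4, h.half], by rw [h5, h.cap], by rw [ha]; exact h.pow⟩

variable {n : ℕ} (o : Finset (Fin n) → ℕ)

theorem Env.run {k : ℕ} {s : Store} (h : Env n k s) {c : Cmd}
    (hr : ∀ x ∈ [rN, rLimit, rDim, rRows, rHalf, rCap], c.writes x = false)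
    (ha : c.stores aPow = false) : Env n k (c.run o s) :=
  h.congr (fun x hx => run_reg o (hr x hx) s) (run_arr o ha s)

theorem Env.setReg {k : ℕ} {s : Store} (h : Env n k s) {x : ℕ} (v : ℕ)
    (hx : x ∉ [rN, rLimit, rDim, rRows, rHalf, rCap]) : Env n k (s.setReg x v) :=
  h.congr (fun y hy => by rw [Store.setReg_reg, if_neg (by rintro rfl; exact hx hy)]) rfl

theorem Env.frame {k x : ℕ} {c : Cmd} {s st : Store} (h : Env n k s)
    (hz : ∀ z, c.writes z = false → z ≠ x → st.reg z = s.reg z)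
    (hs : ∀ a, c.stores a = false → st.arr a = s.arr a)
    (hr : ∀ x ∈ [rN, rLimit, rDim, rRows, rHalf, rCap], c.writes x = false)
    (hx : x ∉ [rN, rLimit, rDim, rRows, rHalf, rCap])
    (ha : c.stores aPow = false) : Env n k st :=
  h.congr (fun y hy => hz y (hr y hy) (by rintro rfl; exact hx hy)) (hs _ ha)

def signBody : Cmd :=
  .ite ((entry aLev rElt).lt (.reg rLow) |>.and
      (Expr.lt 1 (.reg rRow / entry aPow rLow % 2 + entry aSlot rElt / entry aPow rLow % 2)))
    (.assign rSign ((.reg rSign + .reg rSign) % 3)) .skip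

/-- The sign of the coin `rElt` in the weighing `rRow`. -/
def signCmd : Cmd :=
  .seq (.assign rPow (.get aPow (entry aLev rElt + 1)))
  (.seq (.assign rSign ((Expr.reg rRow % .reg rPow).eq (entry aSlot rElt % .reg rPow)))
  (.loop rLow rDim signBody))

theorem signCmd_spec {k : ℕ} {s : Store} (hE : Env n k s) (hk : k ≤ 4 * n + 7)
    (hl : s.arr aLev (s.reg rElt) < k) :
    (signCmd.run o s).reg rSign =
      sgn (s.arr aLev (s.reg rElt)) (s.arr aSlot (s.reg rElt)) (s.reg rRow) k := by
  simp only [signCmd, run_seq, run_assign]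
  obtain ⟨st, h, hI⟩ := loop_rule o (x := rLow) (y := rDim) (c := signBody) (b := k)
    (s := (s.setReg rPow ((Expr.get aPow (entry aLev rElt + 1)).eval s)).setReg rSign
      (((Expr.reg rRow % .reg rPow).eq (entry aSlot rElt % .reg rPow)).eval
        (s.setReg rPow ((Expr.get aPow (entry aLev rElt + 1)).eval s))))
    (by simp [hE.dim]) (by simp [hE.limit]; omega)
    (fun b st => st.reg rSign =
      sgn (s.arr aLev (s.reg rElt)) (s.arr aSlot (s.reg rElt)) (s.reg rRow) b)
    (by simp [hE.pow _ (show s.arr aLev (s.reg rElt) + 1 < 4 * n + 8 by omega), sgn])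
    (by
      intro b st hb hz ha hI
      have e1 := hz rElt rfl (by decide)
      have e2 := hz rRow rfl (by decide)
      have e3 := ha aLev rfl
      have e4 := ha aSlot rfl
      have e5 := ha aPow rfl
      simp at e1 e2 e3 e4 e5
      simp only [signBody, run_ite, run_assign, run_skip]
      simp [e1, e2, e3, e4, e5, hE.pow b (by omega), sgn]
      split_ifs <;> simp_all)
  rw [h]
  simpa using hI

end RankQuery

/-! ### Weighing one chunk of coins -/

namespace RankQuery
open Cmd

/-- The coins in `Z` form the chunk number `rChunk` and sit in distinct slots. -/
structure Chunk (n k : ℕ) (Z : Finset ℕ) (s : Store) : Prop extends Env n k s where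
  dim_le : k ≤ 4 * n + 7
  rows_le : 2 ^ k ≤ 4 * n + 8
  mem : ∀ v, v ∈ Z ↔ v < n ∧ 0 < s.arr aCoin v ∧ s.arr aChunk v = s.reg rChunk
  lev : ∀ v ∈ Z, s.arr aLev v < k
  even : ∀ v ∈ Z, s.arr aSlot v / 2 ^ s.arr aLev v % 2 = 0
  slot : ∀ v ∈ Z, s.arr aSlot v + 2 ^ s.arr aLev v < 2 ^ k
  inj : ∀ u ∈ Z, ∀ v ∈ Z, s.arr aLev u = s.arr aLev v → s.arr aSlot u = s.arr aSlot v → u = v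

theorem Chunk.congr {n k : ℕ} {Z : Finset ℕ} {s s' : Store} (h : Chunk n k Z s)
    (hr : ∀ x ∈ [rN, rLimit, rDim, rRows, rHalf, rCap, rChunk], s'.reg x = s.reg x)
    (ha : ∀ a ∈ [aPow, aCoin, aChunk, aLev, aSlot], s'.arr a = s.arr a) : Chunk n k Z s' := by
  have hE : Env n k s' := h.toEnv.congr (fun x hx => hr x (by simp at hx ⊢; tauto))
    (ha _ (by simp))
  simp at hr ha
  obtain ⟨-, a1, a2, a3, a4⟩ := ha
  have hc := hr.2.2.2.2.2.2
  exact ⟨hE, h.dim_le, h.rows_le, by rw [a1, a2, hc]; exact h.mem, by rw [a3]; exact h.lev,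
    by rw [a3, a4]; exact h.even, by rw [a3, a4]; exact h.slot, by rw [a3, a4]; exact h.inj⟩

theorem Chunk.setReg {n k : ℕ} {Z : Finset ℕ} {s : Store} (h : Chunk n k Z s) {x : ℕ} (v : ℕ)
    (hx : x ∉ [rN, rLimit, rDim, rRows, rHalf, rCap, rChunk]) : Chunk n k Z (s.setReg x v) :=
  h.congr (fun y hy => by rw [Store.setReg_reg, if_neg (by rintro rfl; exact hx hy)])
    fun _ _ => rfl

theorem Chunk.frame {n k x : ℕ} {Z : Finset ℕ} {c : Cmd} {s st : Store} (h : Chunk n k Z s)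
    (hz : ∀ z, c.writes z = false → z ≠ x → st.reg z = s.reg z)
    (hs : ∀ a, c.stores a = false → st.arr a = s.arr a)
    (hr : ∀ x ∈ [rN, rLimit, rDim, rRows, rHalf, rCap, rChunk], c.writes x = false)
    (hx : x ∉ [rN, rLimit, rDim, rRows, rHalf, rCap, rChunk])
    (ha : ∀ a ∈ [aPow, aCoin, aChunk, aLev, aSlot], c.stores a = false) : Chunk n k Z st :=
  h.congr (fun y hy => hz y (hr y hy) (by rintro rfl; exact hx hy)) fun a h => hs a (ha a h)

variable {n : ℕ} (o : Finset (Fin n) → ℕ) {k : ℕ} {Z : Finset ℕ} {s : Store}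

theorem Chunk.run (h : Chunk n k Z s) {c : Cmd}
    (hr : ∀ x ∈ [rN, rLimit, rDim, rRows, rHalf, rCap, rChunk], c.writes x = false)
    (ha : ∀ a ∈ [aPow, aCoin, aChunk, aLev, aSlot], c.stores a = false) :
    Chunk n k Z (c.run o s) :=
  h.congr (fun x hx => run_reg o (hr x hx) s) fun a h => run_arr o (ha a h) s

theorem Chunk.subset_range (h : Chunk n k Z s) : Z ⊆ Finset.range n := fun v hv => by
  simpa using ((h.mem v).1 hv).1

theorem Chunk.lt (h : Chunk n k Z s) {v : ℕ} (hv : v ∈ Z) : v < n := ((h.mem v).1 hv).1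

theorem Chunk.card_le (h : Chunk n k Z s) : Z.card ≤ n := by
  simpa using Finset.card_le_card h.subset_range

/-- The test whether the coin `rElt` belongs to the chunk `rChunk`. -/
def inChunk : Expr := (Expr.lt 0 (entry aCoin rElt)).and ((entry aChunk rElt).eq (.reg rChunk))

theorem Chunk.eval_inChunk (h : Chunk n k Z s) (hv : s.reg rElt < n) :
    inChunk.eval s = if s.reg rElt ∈ Z then 1 else 0 := by
  simp [inChunk, h.mem, hv]

/-- The sign of the coin `rElt` in the weighing `rRow`, or `0` if it is not in the chunk. -/
def chunkSign : Cmd := .seq (.assign rSign 0) (.ite inChunk signCmd .skip)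

theorem chunkSign_spec (h : Chunk n k Z s) (hv : s.reg rElt < n) :
    (chunkSign.run o s).reg rSign = if s.reg rElt ∈ Z then
      sgn (s.arr aLev (s.reg rElt)) (s.arr aSlot (s.reg rElt)) (s.reg rRow) k else 0 := by
  have h' := h.setReg (x := rSign) 0 (by decide)
  have ht := h'.eval_inChunk (by simpa using hv)
  simp only [Store.setReg_reg] at ht
  simp only [chunkSign, run_seq, run_assign, run_ite, Expr.eval_zero, ht]
  by_cases hZ : s.reg rElt ∈ Z
  · simpa [hZ] using signCmd_spec o h'.toEnv h.dim_le (by simpa using h.lev _ hZ)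
  · simp [hZ]

def splitBody : Cmd :=
  .seq chunkSign
  (.seq (.store aPlus (.reg rElt) (entry aTarget rElt + (Expr.reg rSign).eq 1))
  (.seq (.store aMinus (.reg rElt) (entry aTarget rElt + (Expr.reg rSign).eq 2))
  (.seq (.assign rPlus (.reg rPlus + (Expr.reg rSign).eq 1))
  (.assign rMinus (.reg rMinus + (Expr.reg rSign).eq 2)))))

/-- Split the chunk by the signs in the weighing `rRow`. -/
def splitCmd : Cmd :=
  .seq (.assign rPlus 0) (.seq (.assign rMinus 0) (.loop rElt rN splitBody))

theorem splitCmd_spec (h : Chunk n k Z s) :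
    let t := fun v => sgn (s.arr aLev v) (s.arr aSlot v) (s.reg rRow) k
    (∀ v < n, (splitCmd.run o s).arr aPlus v ≠ 0 ↔ s.arr aTarget v ≠ 0 ∨ v ∈ Z ∧ t v = 1) ∧
    (∀ v < n, (splitCmd.run o s).arr aMinus v ≠ 0 ↔ s.arr aTarget v ≠ 0 ∨ v ∈ Z ∧ t v = 2) ∧
    (splitCmd.run o s).reg rPlus = (Z.filter fun v => t v = 1).card ∧
    (splitCmd.run o s).reg rMinus = (Z.filter fun v => t v = 2).card := by
  intro t
  have filter_eq : ∀ c, ((Finset.range n).filter fun v => v ∈ Z ∧ t v = c) =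
      Z.filter fun v => t v = c := by
    intro c
    ext v
    have := h.lt (v := v)
    simp
    tauto
  simp only [splitCmd, run_seq, run_assign, Expr.eval_zero, ← filter_eq]
  have h1 : Chunk n k Z ((s.setReg rPlus 0).setReg rMinus 0) :=
    (h.setReg 0 (by decide)).setReg 0 (by decide)
  obtain ⟨st, hst, hI⟩ := loop_rule o (x := rElt) (y := rN) (c := splitBody) (b := n)
    h1.size (by rw [h1.limit]; omega)
    (fun i st =>
      (∀ v < i, st.arr aPlus v ≠ 0 ↔ s.arr aTarget v ≠ 0 ∨ v ∈ Z ∧ t v = 1) ∧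
      (∀ v < i, st.arr aMinus v ≠ 0 ↔ s.arr aTarget v ≠ 0 ∨ v ∈ Z ∧ t v = 2) ∧
      st.reg rPlus = ((Finset.range i).filter fun v => v ∈ Z ∧ t v = 1).card ∧
      st.reg rMinus = ((Finset.range i).filter fun v => v ∈ Z ∧ t v = 2).card)
    (by simp)
    (by
      rintro i st hi hz ha ⟨i1, i2, i3, i4⟩
      have hC : Chunk n k Z (st.setReg rElt i) :=
        (h1.frame hz ha (by decide) (by decide) (by decide)).setReg i (by decide)
      have hs := chunkSign_spec o hC (by simpa using hi)
      have e0 := hz rRow rfl (by decide)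
      have e1 := ha aTarget rfl
      have e2 := ha aLev rfl
      have e3 := ha aSlot rfl
      simp at e0 e1 e2 e3
      have r1 := run_reg o (c := chunkSign) (z := rElt) rfl (st.setReg rElt i)
      have r2 := run_reg o (c := chunkSign) (z := rPlus) rfl (st.setReg rElt i)
      have r3 := run_reg o (c := chunkSign) (z := rMinus) rfl (st.setReg rElt i)
      have r4 := run_arr o (c := chunkSign) (a := aTarget) rfl (st.setReg rElt i)
      have r5 := run_arr o (c := chunkSign) (a := aPlus) rfl (st.setReg rElt i)
      have r6 := run_arr o (c := chunkSign) (a := aMinus) rfl (st.setReg rElt i)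
      simp [e0, e2, e3] at hs r1 r2 r3 r4 r5 r6
      simp only [splitBody, run_seq, run_store, run_assign]
      generalize chunkSign.run o (st.setReg rElt i) = s' at *
      have hs' : s'.reg rSign = if i ∈ Z then t i else 0 := hs
      simp only [Store.setReg_arr, Store.setArr_arr, Store.setReg_reg, Store.setArr_reg,
        Function.update_apply, entry, Expr.eval_add, Expr.eval_get, Expr.eval_reg, Expr.eval_eq,
        Expr.eval_ofNat, r1, r2, r3, r4, r5, r6, e1, hs', Nat.reduceEqDiff,
        if_true, if_false, i3, i4, Finset.range_add_one, Finset.filter_insert]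
      refine ⟨fun v hv => ?_, fun v hv => ?_, ?_, ?_⟩
      · by_cases hvi : v = i
        · subst hvi; by_cases hZ : v ∈ Z <;> simp [hZ, or_iff_not_imp_left]
        · simpa [hvi] using i1 v (by omega)
      · by_cases hvi : v = i
        · subst hvi; by_cases hZ : v ∈ Z <;> simp [hZ, or_iff_not_imp_left]
        · simpa [hvi] using i2 v (by omega)
      · by_cases hZ : i ∈ Z <;> simp [hZ]; split_ifs <;> simp
      · by_cases hZ : i ∈ Z <;> simp [hZ]; split_ifs <;> simp)
  rw [hst]
  simpa using hI

/-- The answer to whether `v` lies in a common class with an element of `U`. -/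
def hit {α : Type*} [DecidableEq α] (cls : ℕ → α) (U : Finset ℕ) (v : ℕ) : ℕ :=
  if cls v ∈ U.image cls then 1 else 0

/-- The elements of the universe with a nonzero entry in array `a`. -/
def Store.supp (s : Store) (n a : ℕ) : Finset ℕ := (Finset.range n).filter fun v => s.arr a v ≠ 0

@[simp] theorem Store.setReg_supp (s : Store) (x v n a : ℕ) :
    (s.setReg x v).supp n a = s.supp n a := rfl

/-- Two queries for the weighing `rRow`. -/
def rowCmd : Cmd :=
  .seq splitCmd
  (.seq (.query rAskPlus aPlus)
  (.seq (.query rAskMinus aMinus)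
  (.store aForm (.reg rRow)
    (.reg rN + .reg rPlus + .reg rAskMinus - (.reg rMinus + .reg rAskPlus)))))

variable {α : Type*} [DecidableEq α] {cls : ℕ → α}
  (ho : ∀ (s : Store) (a : ℕ), o (s.set n a) = ((s.supp n a).image cls).card)

include ho in
theorem rowCmd_spec (h : Chunk n k Z s) (hr : s.reg rRow < 2 ^ k) (hZ : Set.InjOn cls Z) :
    ∃ y : ℕ, (rowCmd.run o s).arr aForm = Function.update (s.arr aForm) (s.reg rRow) y ∧
      (y : ℤ) = n + form Z (s.arr aLev) (s.arr aSlot) (hit cls (s.supp n aTarget)) k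
        (s.reg rRow) := by
  obtain ⟨h1, h2, h3, h4⟩ := splitCmd_spec o h
  have r1 := run_reg o (c := splitCmd) (z := rRow) rfl s
  have r2 := run_reg o (c := splitCmd) (z := rN) rfl s
  have r3 := run_arr o (c := splitCmd) (a := aForm) rfl s
  simp only [rowCmd, run_seq, run_store, run_query, ho]
  generalize splitCmd.run o s = s' at *
  have sp : ∀ a c, (∀ v < n, s'.arr a v ≠ 0 ↔ s.arr aTarget v ≠ 0 ∨ v ∈ Z ∧
      sgn (s.arr aLev v) (s.arr aSlot v) (s.reg rRow) k = c) →
      s'.supp n a = s.supp n aTarget ∪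
        Z.filter fun v => sgn (s.arr aLev v) (s.arr aSlot v) (s.reg rRow) k = c := by
    intro a c hac
    ext v
    have := h.lt (v := v)
    have := hac v
    simp [Store.supp] at *
    tauto
  have hp := sp _ _ h1
  have hm := sp _ _ h2
  refine ⟨_, by simp [r1, r3]; rfl, ?_⟩
  simp only [hp, hm, r2, h3, h4, h.size]
  rw [signed_weighing cls hZ h.card_le, form, Finset.filter_true_of_mem fun v hv => h.lev v hv]
  congr 1
  refine Finset.sum_congr rfl fun v hv => ?_
  -- Row and slot are both below `2 ^ k`, so at the last stage the block condition in `coef` holds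
  -- and only the sign remains.
  have := h.slot v hv
  rw [coef, Nat.div_eq_of_lt hr, Nat.div_eq_of_lt ((Nat.le_add_right _ _).trans_lt this),
    if_pos rfl, hit]

/-- All weighings of the chunk `rChunk`. -/
def measureCmd : Cmd := .loop rRow rRows rowCmd

include ho in
theorem measureCmd_spec (h : Chunk n k Z s) (hZ : Set.InjOn cls Z) :
    (∀ r < 2 ^ k, ((measureCmd.run o s).arr aForm r : ℤ) =
      n + form Z (s.arr aLev) (s.arr aSlot) (hit cls (s.supp n aTarget)) k r) ∧
    measureCmd.cost o s = 2 * 2 ^ k := by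
  obtain ⟨st, hst, hI⟩ := loop_rule_cost o (x := rRow) (y := rRows) (c := rowCmd) (b := 2 ^ k)
    (s := s) h.rows (by rw [h.limit]; exact h.rows_le)
    (fun i st q => (∀ r < i, (st.arr aForm r : ℤ) =
      n + form Z (s.arr aLev) (s.arr aSlot) (hit cls (s.supp n aTarget)) k r) ∧ q = 2 * i)
    (by simp)
    (by
      rintro i st q hi hz ha ⟨i1, rfl⟩
      have hC : Chunk n k Z (st.setReg rRow i) :=
        (h.frame hz ha (by decide) (by decide) (by decide)).setReg i (by decide)
      obtain ⟨y, hy, hy'⟩ := rowCmd_spec o ho hC (by simpa using hi) hZ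
      have e1 := ha aTarget rfl
      have e2 := ha aLev rfl
      have e3 := ha aSlot rfl
      have e4 : (st.setReg rRow i).supp n aTarget = s.supp n aTarget := by simp [Store.supp, e1]
      rw [e4] at hy'
      simp [e2, e3] at hy hy'
      rw [hy]
      constructor
      · intro r hr
        by_cases hri : r = i
        · subst hri; simpa using hy'
        · simpa [hri] using i1 r (by omega)
      · have : splitCmd.cost o (st.setReg rRow i) = 0 := cost_eq_zero o rfl _
        simp [rowCmd, this, cost]
        ring)
  refine ⟨?_, hI.2⟩
  rw [measureCmd, hst]
  simpa using hI.1

end RankQuery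

/-! ### Decoding the weighings, stage by stage -/

namespace RankQuery
open Cmd

theorem add_two_pow_lt {r b k : ℕ} (hb : b < k) (hr : r < 2 ^ k) (h : r / 2 ^ b % 2 = 0) :
    r + 2 ^ b < 2 ^ k := by
  have e : (2 : ℕ) ^ k = 2 ^ b * (2 * 2 ^ (k - b - 1)) := by
    rw [← pow_succ', ← pow_add]; congr 1; omega
  have h1 : r / 2 ^ b < 2 * 2 ^ (k - b - 1) := by
    rw [Nat.div_lt_iff_lt_mul (by positivity), mul_comm, ← e]; exact hr
  rw [e, mul_comm, ← Nat.div_lt_iff_lt_mul (by positivity), Nat.add_div_right _ (by positivity)]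
  omega

theorem exists_add_two_pow {r b : ℕ} (h : r / 2 ^ b % 2 ≠ 0) :
    ∃ r', r = r' + 2 ^ b ∧ r' / 2 ^ b % 2 = 0 := by
  have h1 : 2 ^ b ≤ r := by
    by_contra hlt
    rw [Nat.div_eq_of_lt (by omega)] at h
    simp at h
  refine ⟨r - 2 ^ b, by omega, ?_⟩
  have : r / 2 ^ b = (r - 2 ^ b) / 2 ^ b + 1 := by
    rw [← Nat.add_div_right _ (by positivity), Nat.sub_add_cancel h1]
  omega

variable {n : ℕ} (o : Finset (Fin n) → ℕ) {k : ℕ} {Z : Finset ℕ} {s : Store}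

def readBody : Cmd :=
  .ite (inChunk.and ((entry aLev rElt).eq (.reg rStage)))
    (.store aHit (.reg rElt)
      ((.get aForm (entry aSlot rElt) + .get aForm (entry aSlot rElt + .reg rPow)) % 2))
    .skip

/-- Read off the weights of the coins of level `rStage`. -/
def readCmd : Cmd := .loop rElt rN readBody

theorem readCmd_spec (h : Chunk n k Z s) :
    ∀ v < n, (readCmd.run o s).arr aHit v = if v ∈ Z ∧ s.arr aLev v = s.reg rStage then
      (s.arr aForm (s.arr aSlot v) + s.arr aForm (s.arr aSlot v + s.reg rPow)) % 2
      else s.arr aHit v := by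
  obtain ⟨st, hst, hI⟩ := loop_rule o (x := rElt) (y := rN) (c := readBody) (b := n) (s := s)
    h.size (by rw [h.limit]; omega)
    (fun i st => ∀ v, st.arr aHit v = if v < i ∧ v ∈ Z ∧ s.arr aLev v = s.reg rStage then
      (s.arr aForm (s.arr aSlot v) + s.arr aForm (s.arr aSlot v + s.reg rPow)) % 2
      else s.arr aHit v)
    (by simp)
    (by
      intro i st hi hz ha hI v
      have hC : Chunk n k Z (st.setReg rElt i) :=
        (h.frame hz ha (by decide) (by decide) (by decide)).setReg i (by decide)
      have ht := hC.eval_inChunk (by simpa using hi)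
      have e1 := hz rStage rfl (by decide)
      have e2 := hz rPow rfl (by decide)
      have e3 := ha aLev rfl
      have e4 := ha aSlot rfl
      have e5 := ha aForm rfl
      simp only [readBody, run_ite, run_store, run_skip, Expr.eval_and, ht, Expr.eval_eq,
        Store.setReg_reg, Store.setReg_arr, e1, e2, e3, e4, e5, Nat.reduceEqDiff, if_true,
        if_false, eval_entry, Expr.eval_reg, Expr.eval_get, Expr.eval_add, Expr.eval_mod,
        Expr.eval_ofNat, one_lt_ite_add_ite]
      by_cases hvi : v = i
      · subst hvi
        split_ifs <;> simp_all
      · have : v < i + 1 ↔ v < i := by omega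
        split_ifs <;> simp_all)
  intro v hv
  rw [readCmd, hst, Store.setReg_arr, hI v]
  simp [hv]

def nextBody : Cmd :=
  .ite ((Expr.reg rRow / .reg rPow % 2).eq 0)
    (.store aNext (.reg rRow)
      ((entry aForm rRow + .get aForm (.reg rRow + .reg rPow)) / 2))
    (.store aNext (.reg rRow)
      ((.get aForm (.reg rRow - .reg rPow) + .reg rN + .reg rN - entry aForm rRow) / 2))

/-- Compute the forms of the previous stage. -/
def nextCmd : Cmd := .loop rRow rRows nextBody

theorem nextCmd_spec (h : Chunk n k Z s) :
    ∀ r < 2 ^ k, (nextCmd.run o s).arr aNext r = if r / s.reg rPow % 2 = 0 then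
      (s.arr aForm r + s.arr aForm (r + s.reg rPow)) / 2 else
      (s.arr aForm (r - s.reg rPow) + n + n - s.arr aForm r) / 2 := by
  obtain ⟨st, hst, hI⟩ := loop_rule o (x := rRow) (y := rRows) (c := nextBody) (b := 2 ^ k)
    (s := s) h.rows (by rw [h.limit]; exact h.rows_le)
    (fun i st => ∀ r < i, st.arr aNext r = if r / s.reg rPow % 2 = 0 then
      (s.arr aForm r + s.arr aForm (r + s.reg rPow)) / 2 else
      (s.arr aForm (r - s.reg rPow) + n + n - s.arr aForm r) / 2)
    (by simp)
    (by
      intro i st hi hz ha hI r hr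
      have e1 := hz rPow rfl (by decide)
      have e2 := ha aForm rfl
      have e3 := (hz rN rfl (by decide)).trans h.size
      simp [nextBody, apply_ite (fun t : Store => t.arr), e1, e2, e3]
      by_cases hri : r = i
      · subst hri
        split_ifs <;> simp
      · have := hI r (by omega)
        split_ifs <;> simp_all)
  intro v hv
  rw [nextCmd, hst, Store.setReg_arr, hI v hv]

/-- The new values at `r` and `r + 2 ^ b` each need both old ones, so they are computed in `aNext`
and copied back only afterwards. -/
def copyBody : Cmd := .store aForm (.reg rRow) (entry aNext rRow)

def copyCmd : Cmd := .loop rRow rRows copyBody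

theorem copyCmd_spec (h : Chunk n k Z s) :
    ∀ r < 2 ^ k, (copyCmd.run o s).arr aForm r = s.arr aNext r := by
  obtain ⟨st, hst, hI⟩ := loop_rule o (x := rRow) (y := rRows) (c := copyBody) (b := 2 ^ k)
    (s := s) h.rows (by rw [h.limit]; exact h.rows_le)
    (fun i st => ∀ r < i, st.arr aForm r = s.arr aNext r)
    (by simp)
    (by
      intro i st hi hz ha hI r hr
      have e2 := ha aNext rfl
      simp [copyBody, e2, Function.update_apply]
      by_cases hri : r = i
      · simp [hri]
      · simpa [hri] using hI r (by omega))
  intro v hv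
  rw [copyCmd, hst, Store.setReg_arr, hI v hv]

def stageBody : Cmd :=
  .seq (.assign rStage (.reg rDim - 1 - .reg rStep))
  (.seq (.assign rPow (entry aPow rStage))
  (.seq readCmd (.seq nextCmd copyCmd)))

theorem stageBody_spec {U : ℕ → ℕ} (hU : ∀ v, U v ≤ 1) (h : Chunk n k Z s) {b : ℕ} (hbk : b < k)
    (hb : b = k - 1 - s.reg rStep)
    (hf : ∀ r < 2 ^ k, (s.arr aForm r : ℤ) = n + form Z (s.arr aLev) (s.arr aSlot) U (b + 1) r) :
    (∀ r < 2 ^ k, ((stageBody.run o s).arr aForm r : ℤ) =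
      n + form Z (s.arr aLev) (s.arr aSlot) U b r) ∧
    ∀ v < n, (stageBody.run o s).arr aHit v =
      if v ∈ Z ∧ s.arr aLev v = b then U v else s.arr aHit v := by
  have p1 : (Expr.reg rDim - 1 - .reg rStep).eval s = b := by simp [h.dim, hb]
  have p2 : (entry aPow rStage).eval (s.setReg rStage b) = 2 ^ b := by
    simpa using h.pow b (by have := h.dim_le; omega)
  simp only [stageBody, run_seq, run_assign, p1, p2]
  have h1 : Chunk n k Z ((s.setReg rStage b).setReg rPow (2 ^ b)) :=
    (h.setReg b (by decide)).setReg _ (by decide)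
  have h2 : Chunk n k Z (readCmd.run o ((s.setReg rStage b).setReg rPow (2 ^ b))) :=
    h1.run o (by decide) (by decide)
  have h3 := h2.run o (c := nextCmd) (by decide) (by decide)
  have s1 := readCmd_spec o h1
  have s2 := nextCmd_spec o h2
  have s3 := copyCmd_spec o h3
  have r1 := run_arr o (c := readCmd) (a := aForm) rfl ((s.setReg rStage b).setReg rPow (2 ^ b))
  have r2 := run_reg o (c := readCmd) (z := rPow) rfl ((s.setReg rStage b).setReg rPow (2 ^ b))
  simp [r1, r2] at s1 s2
  constructor
  · intro r hr
    rw [s3 r hr, s2 r hr]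
    split_ifs with hbit
    · exact (form_decode h.even hU h.inj h.card_le hbit (hf r hr)
        (hf _ (add_two_pow_lt hbk hr hbit))).1
    -- A row with bit `b` set is the second member of the pair `r'`, `r' + 2 ^ b`.
    · obtain ⟨r', rfl, hr'⟩ := exists_add_two_pow hbit
      rw [Nat.add_sub_cancel]
      exact (form_decode h.even hU h.inj h.card_le hr' (hf r' (by omega)) (hf _ hr)).2.1
  · intro v hv
    rw [run_arr o (by rfl), run_arr o (by rfl), s1 v hv]
    refine ite_congr rfl (fun hvZ => ?_) fun _ => rfl
    obtain ⟨hvZ, hlev⟩ := hvZ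
    have hslot := h.slot v hvZ
    have heven := h.even v hvZ
    subst hlev
    rw [(form_decode h.even hU h.inj h.card_le heven
      (hf _ ((Nat.le_add_right _ _).trans_lt hslot)) (hf _ hslot)).2.2, slotSum_eq h.inj hvZ]

/-- Determine the weights of the coins of the chunk `rChunk` from the weighings. -/
def decodeCmd : Cmd := .loop rStep rDim stageBody

theorem decodeCmd_spec {U : ℕ → ℕ} (hU : ∀ v, U v ≤ 1) (h : Chunk n k Z s)
    (hf : ∀ r < 2 ^ k, (s.arr aForm r : ℤ) = n + form Z (s.arr aLev) (s.arr aSlot) U k r) :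
    ∀ v < n, (decodeCmd.run o s).arr aHit v = if v ∈ Z then U v else s.arr aHit v := by
  obtain ⟨st, hst, hI⟩ := loop_rule o (x := rStep) (y := rDim) (c := stageBody) (b := k)
    (s := s) h.dim (by rw [h.limit]; have := h.dim_le; omega)
    -- The stages are undone from `k` downwards: after `i` steps the forms of stage `k - i` are in
    -- memory and the weights of all levels from `k - i` on are known.
    (fun i st => (∀ r < 2 ^ k, (st.arr aForm r : ℤ) =
        n + form Z (s.arr aLev) (s.arr aSlot) U (k - i) r) ∧
      ∀ v < n, st.arr aHit v = if v ∈ Z ∧ k - i ≤ s.arr aLev v then U v else s.arr aHit v)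
    (by
      refine ⟨by simpa using hf, fun v hv => ?_⟩
      rw [if_neg]
      rintro ⟨h1, h2⟩
      have := h.lev v h1
      omega)
    (by
      rintro i st hi hz ha ⟨i1, i2⟩
      have hC : Chunk n k Z (st.setReg rStep i) :=
        (h.frame hz ha (by decide) (by decide) (by decide)).setReg i (by decide)
      have e1 := ha aLev rfl
      have e2 := ha aSlot rfl
      have e3 : k - i = k - (i + 1) + 1 := by omega
      obtain ⟨j1, j2⟩ := stageBody_spec o (b := k - (i + 1)) hU hC (by omega) (by simp; omega)
        (by simp only [Store.setReg_arr, e1, e2, ← e3]; exact i1)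
      simp only [Store.setReg_arr, e1, e2] at j1 j2
      refine ⟨j1, fun v hv => ?_⟩
      rw [j2 v hv, i2 v hv]
      by_cases hvZ : v ∈ Z
      · rcases lt_trichotomy (s.arr aLev v) (k - (i + 1)) with h | h | h
        · simp [hvZ, h.ne, show ¬ k - i ≤ s.arr aLev v by omega,
            show ¬ k - (i + 1) ≤ s.arr aLev v by omega]
        · simp [hvZ, h]
        · simp [hvZ, h.ne', show k - i ≤ s.arr aLev v by omega,
            show k - (i + 1) ≤ s.arr aLev v by omega]
      · simp [hvZ])
  intro v hv
  rw [decodeCmd, hst, Store.setReg_arr, hI.2 v hv]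
  simp

end RankQuery

/-! ### Assigning coins to chunks and slots -/

namespace RankQuery
open Cmd

/-- Insert a zero at bit position `l`. -/
def insertZero (r l : ℕ) : ℕ := r + (r - r % 2 ^ l)

/-- Since r - r % 2^l is the part of `r` from bit `l` on, adding it to `r` doubles this part and
keeps the low bits, without any multiplication. -/
theorem insertZero_eq (r l : ℕ) :
    insertZero r l = 2 ^ l * (2 * (r / 2 ^ l)) + r % 2 ^ l := by
  have h1 := Nat.div_add_mod r (2 ^ l)
  have h2 : 2 ^ l * (2 * (r / 2 ^ l)) = 2 * (2 ^ l * (r / 2 ^ l)) := by ring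
  unfold insertZero
  omega

theorem insertZero_div (r l : ℕ) : insertZero r l / 2 ^ l = 2 * (r / 2 ^ l) := by
  rw [insertZero_eq, Nat.mul_add_div (by positivity),
    Nat.div_eq_of_lt (Nat.mod_lt _ (by positivity)), add_zero]

theorem insertZero_mod (r l : ℕ) : insertZero r l % 2 ^ l = r % 2 ^ l := by
  rw [insertZero_eq, Nat.mul_add_mod, Nat.mod_mod]

theorem insertZero_injective {r r' l : ℕ} (h : insertZero r l = insertZero r' l) : r = r' := by
  have h1 := insertZero_div r l
  have h2 := insertZero_mod r l
  rw [h, insertZero_div] at h1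
  rw [h, insertZero_mod] at h2
  rw [← Nat.div_add_mod r (2 ^ l), ← h2, ← Nat.div_add_mod r' (2 ^ l)]
  simp
  rw [show r / 2 ^ l = r' / 2 ^ l by omega]

theorem insertZero_add_lt {r l k : ℕ} (hl : l < k) (hr : r < 2 ^ (k - 1)) :
    insertZero r l + 2 ^ l < 2 ^ k := by
  apply add_two_pow_lt hl
  · have : 2 ^ k = 2 * 2 ^ (k - 1) := by rw [← pow_succ']; congr 1; omega
    unfold insertZero
    omega
  · rw [insertZero_div]; omega

variable {n : ℕ} (o : Finset (Fin n) → ℕ) {k : ℕ} {s : Store}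

def numberBody : Cmd :=
  .ite (Expr.lt 0 (entry aCoin rElt))
    (.seq (.store aNum (.reg rElt) (.reg rNum)) (.assign rNum (.reg rNum + 1))) .skip

/-- Number the coins and count them in `rNum`. -/
def numberCmd : Cmd := .seq (.assign rNum 0) (.loop rElt rN numberBody)

theorem mem_supp {v a : ℕ} : v ∈ s.supp n a ↔ v < n ∧ s.arr a v ≠ 0 := by
  simp [Store.supp]

/-- The number given to a coin is the number of smaller coins. -/
theorem numberCmd_spec (h : Env n k s) :
    (numberCmd.run o s).reg rNum = (s.supp n aCoin).card ∧
    (∀ v ∈ s.supp n aCoin, (numberCmd.run o s).arr aNum v < (s.supp n aCoin).card) ∧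
    Set.InjOn ((numberCmd.run o s).arr aNum) (s.supp n aCoin) := by
  set D := s.supp n aCoin with hD
  obtain ⟨st, hst, h1, h2⟩ := loop_rule o (x := rElt) (y := rN) (c := numberBody) (b := n)
    (s := s.setReg rNum 0) (by simp [h.size]) (by simp [h.limit]; omega)
    (fun i st => st.reg rNum = (D.filter (· < i)).card ∧
      ∀ v ∈ D, v < i → st.arr aNum v = (D.filter (· < v)).card)
    (by simp)
    (by
      rintro i st hi hz ha ⟨h1, h2⟩
      have e1 := ha aCoin rfl
      simp at e1
      have hf : D.filter (· ≤ i) = if i ∈ D then insert i (D.filter (· < i)) else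
          D.filter (· < i) := by
        ext v
        by_cases hv : v = i
        · subst hv; split_ifs <;> simp_all
        · have : v ≤ i ↔ v < i := by omega
          split_ifs <;> simp [hv, this]
      by_cases hiD : i ∈ D
      · have hc : 0 < s.arr aCoin i := Nat.pos_of_ne_zero (mem_supp.1 hiD).2
        simp only [numberBody, run_ite, run_seq, run_store, run_assign]
        simp [e1, hc, hf, hiD, h1, Function.update_apply]
        intro v hv hvi
        by_cases hvi' : v = i
        · simp [hvi']
        · simpa [hvi'] using h2 v hv (by omega)
      · have hc : s.arr aCoin i = 0 := by
          by_contra hne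
          exact hiD (mem_supp.2 ⟨hi, hne⟩)
        simp only [numberBody, run_ite, run_seq, run_store, run_assign, run_skip]
        simp [e1, hc, hf, hiD, h1]
        intro v hv hvi
        exact h2 v hv (hvi.lt_of_ne (by rintro rfl; exact hiD hv)))
  have hall : D.filter (· < n) = D := by
    ext v; simp only [Finset.mem_filter, and_iff_left_iff_imp]; exact fun hv => (mem_supp.1 hv).1
  simp only [numberCmd, run_seq, run_assign, Expr.eval_zero, hst]
  have h2' : ∀ v ∈ D, st.arr aNum v = (D.filter (· < v)).card :=
    fun v hv => h2 v hv (mem_supp.1 hv).1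
  have lt : ∀ u ∈ D, ∀ v, u < v → st.arr aNum u < (D.filter (· < v)).card := by
    intro u hu v huv
    rw [h2' u hu]
    apply Finset.card_lt_card
    rw [Finset.ssubset_iff_of_subset]
    · exact ⟨u, by simp [hu, huv], by simp⟩
    · intro w hw
      simp at hw ⊢
      exact ⟨hw.1, hw.2.trans huv⟩
  refine ⟨by simpa [hall] using h1, fun v hv => ?_, fun u hu v hv huv => ?_⟩
  · simpa [hall] using lt v hv n (mem_supp.1 hv).1
  · simp at huv
    rcases lt_trichotomy u v with hlt | heq | hgt
    · have := lt u hu v hlt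
      rw [← h2' v hv] at this
      omega
    · exact heq
    · have := lt v hv u hgt
      rw [← h2' u hu] at this
      omega

def placeBody : Cmd :=
  .seq (.store aChunk (.reg rElt) (entry aNum rElt / .reg rCap))
  (.seq (.store aLev (.reg rElt) (entry aNum rElt % .reg rCap / .reg rHalf))
  (.seq (.assign rTemp (entry aNum rElt % .reg rCap % .reg rHalf))
  (.store aSlot (.reg rElt)
    (.reg rTemp + (.reg rTemp - .reg rTemp % .get aPow (entry aLev rElt))))))

/-- Distribute the coins over chunks and slots. -/
def placeCmd : Cmd := .loop rElt rN placeBody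

theorem placeCmd_spec (h : Env n k s) (hk : 1 ≤ k) (hk' : k ≤ 4 * n + 7) :
    ∀ v < n, (placeCmd.run o s).arr aChunk v = s.arr aNum v / (k * 2 ^ (k - 1)) ∧
      (placeCmd.run o s).arr aLev v = s.arr aNum v % (k * 2 ^ (k - 1)) / 2 ^ (k - 1) ∧
      (placeCmd.run o s).arr aSlot v =
        insertZero (s.arr aNum v % (k * 2 ^ (k - 1)) % 2 ^ (k - 1))
          (s.arr aNum v % (k * 2 ^ (k - 1)) / 2 ^ (k - 1)) := by
  obtain ⟨st, hst, hI⟩ := loop_rule o (x := rElt) (y := rN) (c := placeBody) (b := n)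
    (s := s) h.size (by rw [h.limit]; omega)
    (fun i st => ∀ v < i, st.arr aChunk v = s.arr aNum v / (k * 2 ^ (k - 1)) ∧
      st.arr aLev v = s.arr aNum v % (k * 2 ^ (k - 1)) / 2 ^ (k - 1) ∧
      st.arr aSlot v =
        insertZero (s.arr aNum v % (k * 2 ^ (k - 1)) % 2 ^ (k - 1))
          (s.arr aNum v % (k * 2 ^ (k - 1)) / 2 ^ (k - 1)))
    (by simp)
    (by
      intro i st hi hz ha hI v hv
      have hE : Env n k st := h.frame hz ha (by decide) (by decide) (by decide)
      have e1 := ha aNum rfl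
      have hlev : s.arr aNum i % (k * 2 ^ (k - 1)) / 2 ^ (k - 1) < k := by
        rw [Nat.div_lt_iff_lt_mul (by positivity)]
        exact Nat.mod_lt _ (by positivity)
      simp only [placeBody, run_seq, run_store, run_assign]
      by_cases hvi : v = i
      · subst hvi
        simp [e1, hE.cap, hE.half, hE.pow _ (lt_of_lt_of_le hlev (by omega)), insertZero]
      · simpa [hvi] using hI v (by omega))
  intro v hv
  rw [placeCmd, hst, Store.setReg_arr]
  exact hI v hv

def chunkBody : Cmd := .seq measureCmd decodeCmd

/-- Determine, for all elements with a nonzero entry in `aCoin`, whether their class meets the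
set given by `aTarget`. -/
def weighCmd : Cmd :=
  .seq numberCmd
  (.seq placeCmd
  (.seq (.assign rChunks ((.reg rNum + .reg rCap - 1) / .reg rCap))
  (.loop rChunk rChunks chunkBody)))

variable {α : Type*} [DecidableEq α] {cls : ℕ → α}
  (ho : ∀ (s : Store) (a : ℕ), o (s.set n a) = ((s.supp n a).image cls).card)

theorem hit_le_one (cls : ℕ → α) (U : Finset ℕ) (v : ℕ) : hit cls U v ≤ 1 := by
  unfold hit; split_ifs <;> simp

theorem card_supp_le (s : Store) (n a : ℕ) : (s.supp n a).card ≤ n :=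
  (Finset.card_filter_le _ _).trans (by simp)

-- The number of a coin is split in mixed radix into chunk, level and the rest, so coins of one
-- chunk get distinct slots: `k` levels with `2 ^ (k - 1)` slots each. Every chunk costs two queries
-- for each of its `2 ^ k` rows, and the last factor is the number of chunks, rounded up.
include ho in
theorem weighCmd_spec (h : Env n k s) (hk : 1 ≤ k) (hk' : k ≤ 4 * n + 7)
    (hrows : 2 ^ k ≤ 4 * n + 8) (hinj : Set.InjOn cls (s.supp n aCoin)) :
    (∀ v ∈ s.supp n aCoin, (weighCmd.run o s).arr aHit v = hit cls (s.supp n aTarget) v) ∧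
    weighCmd.cost o s =
      2 * 2 ^ k * (((s.supp n aCoin).card + k * 2 ^ (k - 1) - 1) / (k * 2 ^ (k - 1))) := by
  have hcap : 0 < k * 2 ^ (k - 1) := by positivity
  obtain ⟨n1, n2, n3⟩ := numberCmd_spec o h
  have h1 : Env n k (numberCmd.run o s) := h.run o (by decide) (by decide)
  have p := placeCmd_spec o h1 hk hk'
  have h2 : Env n k (placeCmd.run o (numberCmd.run o s)) := h1.run o (by decide) (by decide)
  have f1 : (placeCmd.run o (numberCmd.run o s)).arr aCoin = s.arr aCoin := by
    rw [run_arr o (by rfl), run_arr o (by rfl)]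
  have f2 : (placeCmd.run o (numberCmd.run o s)).arr aTarget = s.arr aTarget := by
    rw [run_arr o (by rfl), run_arr o (by rfl)]
  have f3 : (placeCmd.run o (numberCmd.run o s)).reg rNum = (s.supp n aCoin).card := by
    rw [run_reg o (by rfl), n1]
  have c1 : numberCmd.cost o s = 0 := cost_eq_zero o rfl _
  have c2 : placeCmd.cost o (numberCmd.run o s) = 0 := cost_eq_zero o rfl _
  have c3 : ∀ e x s, (Cmd.assign x e).cost o s = 0 := fun _ _ _ => rfl
  have hch : (((Expr.reg rNum + .reg rCap - 1) / .reg rCap : Expr)).eval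
      (placeCmd.run o (numberCmd.run o s)) =
      ((s.supp n aCoin).card + k * 2 ^ (k - 1) - 1) / (k * 2 ^ (k - 1)) := by
    simp [f3, h2.cap]
  simp only [weighCmd, run_seq, run_assign, cost_seq, c1, c2, c3, hch, zero_add]
  generalize numberCmd.run o s = s1 at *
  generalize placeCmd.run o s1 = s2 at *
  set m := (s.supp n aCoin).card with hm
  set cap := k * 2 ^ (k - 1) with hcap'
  have hmn : m ≤ n := card_supp_le s n aCoin
  -- There are at most `m ≤ n` chunks, so the loop limit does not cut the loop short.
  have hchm : (m + cap - 1) / cap ≤ m := by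
    rcases Nat.eq_zero_or_pos m with h0 | h0
    · rw [h0, Nat.div_eq_of_lt (by omega)]
    · rw [← Nat.lt_add_one_iff, Nat.div_lt_iff_lt_mul hcap, add_one_mul]
      have := Nat.le_mul_of_pos_right m hcap
      omega
  obtain ⟨st, hst, hI, hq⟩ := loop_rule_cost o (x := rChunk) (y := rChunks) (c := chunkBody)
    (s := s2.setReg rChunks ((m + cap - 1) / cap)) (b := (m + cap - 1) / cap)
    (by simp) (by simp [h2.limit]; omega)
    (fun i st q => (∀ v ∈ s.supp n aCoin, s2.arr aChunk v < i →
      st.arr aHit v = hit cls (s.supp n aTarget) v) ∧ q = 2 * 2 ^ k * i)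
    (by simp)
    (by
      rintro i st q hi hz ha ⟨hI, rfl⟩
      have hE : Env n k (st.setReg rChunk i) :=
        ((h2.setReg _ (by decide)).frame hz ha (by decide) (by decide) (by decide)).setReg i
          (by decide)
      have e1 := ha aCoin rfl
      have e2 := ha aChunk rfl
      have e3 := ha aLev rfl
      have e4 := ha aSlot rfl
      have e5 := ha aTarget rfl
      simp only [Store.setReg_arr, f1, f2] at e1 e2 e3 e4 e5
      have hC : Chunk n k ((s.supp n aCoin).filter fun v => s2.arr aChunk v = i)
          (st.setReg rChunk i) := by
        refine ⟨hE, hk', hrows, ?_, ?_, ?_, ?_, ?_⟩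
        · intro v
          simp [e1, e2, mem_supp, Nat.pos_iff_ne_zero, and_assoc]
        all_goals simp only [Store.setReg_arr, e3, e4, Finset.mem_filter]
        · rintro v ⟨hv, -⟩
          rw [(p v (mem_supp.1 hv).1).2.1, Nat.div_lt_iff_lt_mul (by positivity)]
          exact Nat.mod_lt _ hcap
        · rintro v ⟨hv, -⟩
          rw [(p v (mem_supp.1 hv).1).2.1, (p v (mem_supp.1 hv).1).2.2, insertZero_div]
          omega
        · rintro v ⟨hv, -⟩
          rw [(p v (mem_supp.1 hv).1).2.1, (p v (mem_supp.1 hv).1).2.2]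
          apply insertZero_add_lt
          · rw [Nat.div_lt_iff_lt_mul (by positivity)]
            exact Nat.mod_lt _ hcap
          · exact Nat.mod_lt _ (by positivity)
        · rintro u ⟨hu, hu'⟩ v ⟨hv, hv'⟩ hl hs
          obtain ⟨a1, a2, a3⟩ := p u (mem_supp.1 hu).1
          obtain ⟨b1, b2, b3⟩ := p v (mem_supp.1 hv).1
          rw [a2, b2] at hl
          rw [a3, b3, hl] at hs
          have hr := insertZero_injective hs
          have hmod : s1.arr aNum u % cap = s1.arr aNum v % cap := by
            rw [← Nat.div_add_mod (s1.arr aNum u % cap) (2 ^ (k - 1)), hl, hr, Nat.div_add_mod]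
          rw [a1] at hu'
          rw [b1] at hv'
          apply n3 hu hv
          rw [← Nat.div_add_mod (s1.arr aNum u) cap, hmod, hu', ← hv', Nat.div_add_mod]
      obtain ⟨m1, m2⟩ := measureCmd_spec o ho hC
        (hinj.mono (by intro v hv; exact (Finset.mem_filter.mp hv).1))
      have m3 : Chunk n k _ (measureCmd.run o (st.setReg rChunk i)) :=
        hC.run o (by decide) (by decide)
      have g1 := run_arr o (c := measureCmd) (a := aLev) rfl (st.setReg rChunk i)
      have g2 := run_arr o (c := measureCmd) (a := aSlot) rfl (st.setReg rChunk i)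
      have g3 := run_arr o (c := measureCmd) (a := aHit) rfl (st.setReg rChunk i)
      have hsupp : (st.setReg rChunk i).supp n aTarget = s.supp n aTarget := by
        simp [Store.supp, e5]
      rw [hsupp, ← g1, ← g2] at m1
      have d := decodeCmd_spec o (hit_le_one cls _) m3 m1
      have dc : decodeCmd.cost o (measureCmd.run o (st.setReg rChunk i)) = 0 :=
        cost_eq_zero o rfl _
      constructor
      · intro v hv hvi
        simp only [chunkBody, run_seq]
        rw [d v (mem_supp.1 hv).1, g3]
        by_cases hvi' : s2.arr aChunk v = i
        · rw [if_pos (Finset.mem_filter.2 ⟨hv, hvi'⟩)]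
        · rw [if_neg (by simp [hvi'])]
          exact hI v hv (by omega)
      · simp only [chunkBody, cost_seq, m2, dc]
        ring)
  refine ⟨fun v hv => ?_, hq⟩
  rw [hst, Store.setReg_arr]
  refine hI v hv ?_
  rw [(p v (mem_supp.1 hv).1).1, Nat.div_lt_iff_lt_mul hcap]
  have := n2 v hv
  have h3 := Nat.div_add_mod (m + cap - 1) cap
  have h4 := Nat.mod_lt (m + cap - 1) hcap
  rw [mul_comm] at h3
  omega

end RankQuery

namespace RankQuery
open Cmd

/-! ### The learning program -/

variable {n : ℕ} (o : Finset (Fin n) → ℕ) {k : ℕ} {s : Store}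

/-- A loop that fills an array. -/
theorem loop_fill {x y : ℕ} {c : Cmd} {b : ℕ} (hy : s.reg y = b) (hb : b ≤ s.reg rLimit)
    (a : ℕ) (f : ℕ → ℕ)
    (hc : ∀ (i : ℕ) (st : Store), i < b → (∀ z, c.writes z = false → z ≠ x → st.reg z = s.reg z) →
      (∀ a, c.stores a = false → st.arr a = s.arr a) → st.arr a i = s.arr a i →
      (c.run o (st.setReg x i)).arr a = Function.update (st.arr a) i (f i)) (i : ℕ) :
    ((loop x y c).run o s).arr a i = if i < b then f i else s.arr a i := by
  obtain ⟨st, hst, hI⟩ := loop_rule o (x := x) (y := y) (c := c) hy hb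
    (fun i st => ∀ j, st.arr a j = if j < i then f j else s.arr a j)
    (by simp)
    (by
      intro i st hi hz ha hI j
      rw [hc i st hi hz ha (by simpa using hI i), Function.update_apply, hI j]
      by_cases hji : j = i
      · simp [hji]
      · simp [hji, show j < i + 1 ↔ j < i by omega])
  rw [hst, Store.setReg_arr, hI i]

/-- The elements of `[lo, hi)` that are their own labels. -/
def reps (L : ℕ → ℕ) (n lo hi : ℕ) : Finset ℕ :=
  (Finset.range n).filter fun v => L v = v ∧ lo ≤ v ∧ v < hi

/-- The test whether `rElt` is its own label and lies in `[lo, hi)`. -/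
def isRep (lo hi : Expr) : Expr :=
  ((entry aLabel rElt).eq (.reg rElt)).and
    ((lo.lt (.reg rElt + 1)).and ((Expr.reg rElt).lt hi))

theorem eval_isRep (lo hi : Expr) (hv : s.reg rElt < n) :
    (isRep lo hi).eval s =
      if s.reg rElt ∈ reps (s.arr aLabel) n (lo.eval s) (hi.eval s) then 1 else 0 := by
  simp [isRep, reps, hv]

def selectBody : Cmd :=
  .seq (.store aCoin (.reg rElt) (isRep (.reg rPos) (.reg rPos + .reg rBlock)))
    (.store aTarget (.reg rElt) (isRep (.reg rBase) (.reg rPos)))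

/-- Let the representatives in the current block be the coins and those in the previous blocks of
the superblock be the targets. -/
def selectCmd : Cmd := .loop rElt rN selectBody

theorem supp_eq_of_ite {a : ℕ} {D : Finset ℕ} (hD : ∀ v ∈ D, v < n)
    (h : ∀ v < n, s.arr a v = if v ∈ D then 1 else 0) : s.supp n a = D := by
  ext v
  rw [mem_supp]
  constructor
  · rintro ⟨h1, h2⟩
    rw [h v h1] at h2
    by_contra h3
    simp [h3] at h2
  · intro hv
    exact ⟨hD v hv, by rw [h v (hD v hv)]; simp [hv]⟩

/-- A loop that writes an indicator function. -/
theorem loop_select (h : Env n k s) {c : Cmd} {a : ℕ} {D : Finset ℕ} (hD : ∀ v ∈ D, v < n)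
    (hc : ∀ (i : ℕ) (st : Store), i < n →
      (∀ z, c.writes z = false → z ≠ rElt → st.reg z = s.reg z) →
      (∀ a, c.stores a = false → st.arr a = s.arr a) → st.arr a i = s.arr a i →
      (c.run o (st.setReg rElt i)).arr a =
        Function.update (st.arr a) i (if i ∈ D then 1 else 0)) :
    ((loop rElt rN c).run o s).supp n a = D := by
  refine supp_eq_of_ite hD fun v hv => ?_
  rw [loop_fill o h.size (by rw [h.limit]; omega) _ (fun v => if v ∈ D then 1 else 0) hc,
    if_pos hv]

theorem lt_of_mem_reps {L : ℕ → ℕ} {lo hi v : ℕ} (h : v ∈ reps L n lo hi) : v < n := by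
  simp only [reps, Finset.mem_filter, Finset.mem_range] at h
  exact h.1

theorem selectCmd_spec (h : Env n k s) :
    (selectCmd.run o s).supp n aCoin =
      reps (s.arr aLabel) n (s.reg rPos) (s.reg rPos + s.reg rBlock) ∧
    (selectCmd.run o s).supp n aTarget =
      reps (s.arr aLabel) n (s.reg rBase) (s.reg rPos) := by
  constructor
  all_goals
    refine loop_select o h (fun v hv => lt_of_mem_reps hv) fun i st hi hz ha _ => ?_
    have e1 := hz rPos rfl (by decide)
    have e2 := hz rBlock rfl (by decide)
    have e3 := hz rBase rfl (by decide)
    have e4 := ha aLabel rfl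
    have e5 := eval_isRep (s := st.setReg rElt i) (.reg rPos) (.reg rPos + .reg rBlock)
      (by simpa using hi)
    have e6 := eval_isRep (n := n) (s := (st.setReg rElt i).setArr aCoin i
      (if i ∈ reps (s.arr 0) n (s.reg 10) (s.reg 10 + s.reg 4) then 1 else 0))
      (.reg rBase) (.reg rPos) (by simpa using hi)
    simp [e1, e2, e3, e4] at e5 e6
    simp [selectBody, e5, e6]

/-- Entries of `aHit` outside the coins may be left over from earlier weighings, hence the
conjunction. Each partner starts at the beginning of the superblock; its offset is added later, bit
by bit. -/
def keepBody : Cmd :=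
  .seq (.store aCoin (.reg rElt) ((Expr.lt 0 (entry aCoin rElt)).and (Expr.lt 0 (entry aHit rElt))))
    (.store aPartner (.reg rElt) (.reg rBase))

/-- Keep the coins that have a partner. -/
def keepCmd : Cmd := .loop rElt rN keepBody

theorem keepCmd_spec (h : Env n k s) :
    (keepCmd.run o s).supp n aCoin = (s.supp n aCoin).filter (fun v => 0 < s.arr aHit v) ∧
    ∀ v < n, (keepCmd.run o s).arr aPartner v = s.reg rBase := by
  constructor
  · refine loop_select o h (fun v hv => (mem_supp.1 (Finset.mem_filter.1 hv).1).1)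
      fun i st hi hz ha h2 => ?_
    have e1 := ha aHit rfl
    simp [keepBody, e1, h2, mem_supp, hi]
    simp [Nat.pos_iff_ne_zero]
  · intro v hv
    rw [keepCmd, loop_fill o h.size (by rw [h.limit]; omega) _ (fun _ => s.reg rBase), if_pos hv]
    intro i st hi hz ha h2
    have e1 := hz rBase rfl (by decide)
    simp [keepBody, e1]

def targetBody : Cmd :=
  .store aTarget (.reg rElt) ((isRep (.reg rBase) (.reg rPos)).and
    ((Expr.reg rElt / entry aPow rBit % 2).eq 1))

/-- Let the representatives in the previous blocks with bit number `rBit` set be the targets. -/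
def targetCmd : Cmd := .loop rElt rN targetBody

theorem targetCmd_spec (h : Env n k s) (hj : s.reg rBit < 4 * n + 8) :
    (targetCmd.run o s).supp n aTarget =
      (reps (s.arr aLabel) n (s.reg rBase) (s.reg rPos)).filter
        fun v => v / 2 ^ s.reg rBit % 2 = 1 := by
  refine loop_select o h (fun v hv => lt_of_mem_reps (Finset.mem_filter.1 hv).1)
    fun i st hi hz ha _ => ?_
  have e1 := hz rPos rfl (by decide)
  have e2 := hz rBit rfl (by decide)
  have e3 := hz rBase rfl (by decide)
  have e4 := ha aLabel rfl
  have e5 := (congrFun (ha aPow rfl) (s.reg rBit)).trans (h.pow _ hj)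
  have e6 := eval_isRep (n := n) (s := st.setReg rElt i) (.reg rBase) (.reg rPos)
    (by simpa using hi)
  simp [e1, e3, e4] at e6
  simp [targetBody, e2, e5, e6]

def addBody : Cmd :=
  .ite (Expr.lt 0 (entry aHit rElt))
    (.store aPartner (.reg rElt) (entry aPartner rElt + entry aPow rBit)) .skip

/-- Add the bit number `rBit` to the partners. -/
def addCmd : Cmd := .loop rElt rN addBody

theorem addCmd_spec (h : Env n k s) (hj : s.reg rBit < 4 * n + 8) :
    ∀ v < n, (addCmd.run o s).arr aPartner v =
      s.arr aPartner v + if 0 < s.arr aHit v then 2 ^ s.reg rBit else 0 := by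
  intro v hv
  rw [addCmd, loop_fill o h.size (by rw [h.limit]; omega) _ (fun v =>
    s.arr aPartner v + if 0 < s.arr aHit v then 2 ^ s.reg rBit else 0), if_pos hv]
  intro i st hi hz ha h2
  have e1 := ha aHit rfl
  have e2 := hz rBit rfl (by decide)
  have e5 := (congrFun (ha aPow rfl) (s.reg rBit)).trans (h.pow _ hj)
  simp only [addBody, run_ite, run_store, run_skip]
  by_cases hh : 0 < s.arr aHit i
  · simp [e1, hh, e2, e5, h2]
  · simp at hh
    simp [e1, hh, ← h2]

def bitBody : Cmd := .seq targetCmd (.seq weighCmd addCmd)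

/-- Determine the partners bit by bit. -/
def bitsCmd : Cmd := .loop rBit rBits bitBody

variable {α : Type*} [DecidableEq α] {cls : ℕ → α}
  (ho : ∀ (s : Store) (a : ℕ), o (s.set n a) = ((s.supp n a).image cls).card)

/-- The number of queries of the weighing program for `m` coins. -/
def weighCost (k m : ℕ) : ℕ := 2 * 2 ^ k * ((m + k * 2 ^ (k - 1) - 1) / (k * 2 ^ (k - 1)))

-- For each bit, the coins are weighed against those representatives that have the bit set. The
-- answer is the corresponding bit of the partner.
include ho in
theorem bitsCmd_spec (h : Env n k s) (hk : 1 ≤ k) (hk' : 4 * k ≤ 4 * n + 7)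
    (hrows : 2 ^ k ≤ 4 * n + 8) (hbits : s.reg rBits = 4 * k)
    (hM : Set.InjOn cls (s.supp n aCoin))
    (hR : Set.InjOn cls (reps (s.arr aLabel) n (s.reg rBase) (s.reg rPos)))
    (p : ℕ → ℕ)
    (hp : ∀ v ∈ s.supp n aCoin, p v ∈ reps (s.arr aLabel) n (s.reg rBase) (s.reg rPos) ∧
      cls (p v) = cls v) :
    (∀ v ∈ s.supp n aCoin, (bitsCmd.run o s).arr aPartner v =
      s.arr aPartner v + p v % 2 ^ (4 * k)) ∧
    bitsCmd.cost o s = weighCost k (s.supp n aCoin).card * (4 * k) := by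
  obtain ⟨st, hst, hI, hq⟩ := loop_rule_cost o (x := rBit) (y := rBits) (c := bitBody)
    (s := s) (b := 4 * k) hbits (by rw [h.limit]; omega)
    (fun i st q => (∀ v ∈ s.supp n aCoin, st.arr aPartner v = s.arr aPartner v + p v % 2 ^ i) ∧
      q = weighCost k (s.supp n aCoin).card * i)
    (by simp [Nat.mod_one])
    (by
      rintro i st q hi hz ha ⟨hI, rfl⟩
      have hE : Env n k (st.setReg rBit i) :=
        (h.frame hz ha (by decide) (by decide) (by decide)).setReg i (by decide)
      have t := targetCmd_spec o hE (by simp; omega)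
      have hE1 : Env n k (targetCmd.run o (st.setReg rBit i)) := hE.run o (by decide) (by decide)
      have hE2 : Env n k (weighCmd.run o (targetCmd.run o (st.setReg rBit i))) :=
        hE1.run o (by decide) (by decide)
      have e1 := hz rPos rfl (by decide)
      have e2 := hz rBase rfl (by decide)
      have e3 := ha aCoin rfl
      have e4 := ha aLabel rfl
      have f1 := run_arr o (c := targetCmd) (a := aCoin) rfl (st.setReg rBit i)
      have f2 := run_arr o (c := targetCmd) (a := aPartner) rfl (st.setReg rBit i)
      have f3 := run_reg o (c := targetCmd) (z := rBit) rfl (st.setReg rBit i)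
      have g2 := run_arr o (c := weighCmd) (a := aPartner) rfl
        (targetCmd.run o (st.setReg rBit i))
      have g3 := run_reg o (c := weighCmd) (z := rBit) rfl (targetCmd.run o (st.setReg rBit i))
      have hcoin : (targetCmd.run o (st.setReg rBit i)).supp n aCoin = s.supp n aCoin := by
        simp [Store.supp, f1, e3]
      simp [e1, e2, e4] at t f2 f3
      obtain ⟨w, wc⟩ := weighCmd_spec o ho hE1 hk (by omega) hrows (by rw [hcoin]; exact hM)
      rw [hcoin, t] at w
      rw [hcoin, ← weighCost] at wc
      have a := addCmd_spec o hE2 (by rw [g3, f3]; omega)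
      have c1 : targetCmd.cost o (st.setReg rBit i) = 0 := cost_eq_zero o rfl _
      have c2 : addCmd.cost o (weighCmd.run o (targetCmd.run o (st.setReg rBit i))) = 0 :=
        cost_eq_zero o rfl _
      constructor
      · intro v hv
        obtain ⟨p1, p2⟩ := hp v hv
        simp only [bitBody, run_seq]
        rw [a v (mem_supp.1 hv).1, w v hv, g2, g3, f3, f2, hI v hv, Nat.pow_succ, Nat.mod_mul,
          add_assoc]
        congr 2
        -- By `hR`, the partner is the only representative of the class of `v` in the range, so a
        -- hit says precisely that the partner has bit `i` set.
        have key : cls v ∈ ((reps (s.arr aLabel) n (s.reg rBase) (s.reg rPos)).filter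
            fun v => v / 2 ^ i % 2 = 1).image cls ↔ p v / 2 ^ i % 2 = 1 := by
          rw [← p2, Finset.mem_image]
          constructor
          · rintro ⟨u, hu, huv⟩
            rw [Finset.mem_filter] at hu
            rw [← hR hu.1 p1 huv]
            exact hu.2
          · intro hb
            exact ⟨p v, by simp [p1, hb], rfl⟩
        rcases Nat.mod_two_eq_zero_or_one (p v / 2 ^ i) with hb | hb
        · rw [hb] at key ⊢
          simp [hit, key]
        · rw [hb] at key ⊢
          simp [hit, key]
      · simp only [bitBody, cost_seq, c1, c2, wc]
        ring)
  refine ⟨fun v hv => ?_, hq⟩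
  rw [bitsCmd, hst, Store.setReg_arr]
  exact hI v hv

def relabelBody : Cmd :=
  .ite (Expr.lt 0 (.get aCoin (entry aLabel rElt)))
    (.store aLabel (.reg rElt) (.get aPartner (entry aLabel rElt))) .skip

def relabelCmd : Cmd := .loop rElt rN relabelBody

/-- Relabelling in place is safe, as the new label of an element depends on no other entry of
`aLabel`. -/
theorem relabelCmd_spec (h : Env n k s) (hL : ∀ v < n, s.arr aLabel v < n) :
    ∀ v < n, (relabelCmd.run o s).arr aLabel v = if s.arr aLabel v ∈ s.supp n aCoin then
      s.arr aPartner (s.arr aLabel v) else s.arr aLabel v := by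
  intro v hv
  rw [relabelCmd, loop_fill o h.size (by rw [h.limit]; omega) _ (fun v =>
    if s.arr aLabel v ∈ s.supp n aCoin then
      s.arr aPartner (s.arr aLabel v) else s.arr aLabel v), if_pos hv]
  intro i st hi hz ha h2
  have e1 := ha aCoin rfl
  have e2 := ha aPartner rfl
  have := hL i hi
  simp only [relabelBody, run_ite, run_store, run_skip]
  by_cases hh : 0 < s.arr aCoin (s.arr aLabel i)
  · have : s.arr aLabel i ∈ s.supp n aCoin := mem_supp.2 ⟨this, hh.ne'⟩
    simp [e1, hh, e2, h2, this]
  · simp at hh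
    have : s.arr aLabel i ∉ s.supp n aCoin := by simp [mem_supp, hh]
    simp only [if_neg this]
    simp [e1, hh, h2]

/-- Merge the block at `rPos` with the previous blocks of its superblock. -/
def mergeCmd : Cmd :=
  .seq (.assign rBase (.reg rPos - .reg rPos % .reg rSuper))
  (.seq selectCmd
  (.seq weighCmd
  (.seq keepCmd
  (.seq bitsCmd relabelCmd))))

-- One weighing of all coins of the block selects the set `M` of those with a partner; only these
-- take part in the `4 * k` weighings for the bits. This is why the expensive term of the cost
-- depends on `M` alone.
include ho in
theorem mergeCmd_spec (h : Env n k s) (hk : 1 ≤ k) (hk' : 4 * k ≤ 4 * n + 7)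
    (hrows : 2 ^ k ≤ 4 * n + 8) (hbits : s.reg rBits = 4 * k)
    (hsuper : s.reg rSuper = 2 ^ (4 * k)) {a b : ℕ} (hpos : s.reg rPos = a)
    (hblock : s.reg rBlock = b) (hL : ∀ v < n, s.arr aLabel v < n)
    (hC : Set.InjOn cls (reps (s.arr aLabel) n a (a + b)))
    (hR : Set.InjOn cls (reps (s.arr aLabel) n (a - a % 2 ^ (4 * k)) a)) :
    ∃ (M : Finset ℕ) (p : ℕ → ℕ),
      M = (reps (s.arr aLabel) n a (a + b)).filter (fun v =>
        cls v ∈ (reps (s.arr aLabel) n (a - a % 2 ^ (4 * k)) a).image cls) ∧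
      (∀ v ∈ M, p v ∈ reps (s.arr aLabel) n (a - a % 2 ^ (4 * k)) a ∧ cls (p v) = cls v) ∧
      (∀ v < n, (mergeCmd.run o s).arr aLabel v =
        if s.arr aLabel v ∈ M then p (s.arr aLabel v) else s.arr aLabel v) ∧
      mergeCmd.cost o s = weighCost k (reps (s.arr aLabel) n a (a + b)).card +
        weighCost k M.card * (4 * k) := by
  set L := s.arr aLabel with hLdef
  set A := a - a % 2 ^ (4 * k) with hA
  set C := reps L n a (a + b) with hCdef
  set R := reps L n A a with hRdef
  set M := C.filter fun v => cls v ∈ R.image cls with hM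
  have hMR : ∀ v, ∃ u, v ∈ M → u ∈ R ∧ cls u = cls v := by
    intro v
    by_cases hv : v ∈ M
    · obtain ⟨u, hu⟩ := Finset.mem_image.1 (Finset.mem_filter.1 hv).2
      exact ⟨u, fun _ => hu⟩
    · exact ⟨0, fun h => absurd h hv⟩
  choose p hp using hMR
  refine ⟨M, p, rfl, hp, ?_⟩
  have ebase : (Expr.reg rPos - .reg rPos % .reg rSuper).eval s = A := by
    simp [hpos, hsuper, hA]
  simp only [mergeCmd, run_seq, run_assign, ebase, cost_seq]
  have c0 : (Cmd.assign rBase (.reg rPos - .reg rPos % .reg rSuper)).cost o s = 0 := rfl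
  set s0 := s.setReg rBase A with hs0
  have h0 : Env n k s0 := h.setReg _ (by decide)
  set s1 := selectCmd.run o s0 with hs1
  have h1 : Env n k s1 := h0.run o (by decide) (by decide)
  set s2 := weighCmd.run o s1 with hs2
  have h2 : Env n k s2 := h1.run o (by decide) (by decide)
  set s3 := keepCmd.run o s2 with hs3
  have h3 : Env n k s3 := h2.run o (by decide) (by decide)
  set s4 := bitsCmd.run o s3 with hs4
  have h4 : Env n k s4 := h3.run o (by decide) (by decide)
  have c1 : selectCmd.cost o s0 = 0 := cost_eq_zero o rfl _
  have c2 : keepCmd.cost o s2 = 0 := cost_eq_zero o rfl _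
  have c3 : relabelCmd.cost o s4 = 0 := cost_eq_zero o rfl _
  -- the memory between the steps
  have lab1 : s1.arr aLabel = L := by rw [hs1, run_arr o (by rfl)]; rfl
  have lab3 : s3.arr aLabel = L := by rw [hs3, run_arr o (by rfl), hs2, run_arr o (by rfl), lab1]
  have lab4 : s4.arr aLabel = L := by rw [hs4, run_arr o (by rfl), lab3]
  have base2 : s2.reg rBase = A := by
    rw [hs2, run_reg o (by rfl), hs1, run_reg o (by rfl)]; simp [hs0]
  have base3 : s3.reg rBase = A := by rw [hs3, run_reg o (by rfl), base2]
  have pos3 : s3.reg rPos = a := by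
    rw [hs3, run_reg o (by rfl), hs2, run_reg o (by rfl), hs1, run_reg o (by rfl)]
    simp [hs0, hpos]
  have bits3 : s3.reg rBits = 4 * k := by
    rw [hs3, run_reg o (by rfl), hs2, run_reg o (by rfl), hs1, run_reg o (by rfl)]
    simp [hs0, hbits]
  obtain ⟨sel1, sel2⟩ := selectCmd_spec o h0
  rw [← hs1] at sel1 sel2
  simp only [hs0, Store.setReg_arr, Store.setReg_reg, Nat.reduceEqDiff, if_true, if_false, hpos,
    hblock, ← hLdef, ← hCdef, ← hRdef] at sel1 sel2
  obtain ⟨w, wc⟩ := weighCmd_spec o ho h1 hk (by omega) hrows (by rw [sel1]; exact hC)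
  rw [sel1, sel2, ← hs2] at w
  rw [sel1] at wc
  obtain ⟨k1, k2⟩ := keepCmd_spec o h2
  have coin2 : s2.supp n aCoin = C := by
    rw [← sel1]
    simp only [Store.supp, hs2, run_arr o (c := weighCmd) (a := aCoin) rfl]
  have coin3 : s3.supp n aCoin = M := by
    rw [hs3, k1, coin2, hM]
    refine Finset.filter_congr fun v hv => ?_
    rw [w v hv, hit]
    split_ifs with hh <;> simp [hh]
  have coin4 : s4.supp n aCoin = M := by
    rw [← coin3]
    simp only [Store.supp, hs4, run_arr o (c := bitsCmd) (a := aCoin) rfl]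
  obtain ⟨b1, b2⟩ := bitsCmd_spec o ho h3 hk hk' hrows bits3
    (by rw [coin3]; exact hC.mono (by intro v hv; exact (Finset.mem_filter.mp hv).1))
    (by rw [lab3, base3, pos3]; exact hR) p
    (by rw [coin3, lab3, base3, pos3]; exact hp)
  rw [coin3] at b1 b2
  refine ⟨fun v hv => ?_, ?_⟩
  · rw [relabelCmd_spec o h4 (by rw [lab4]; exact hL) v hv, lab4, coin4]
    refine ite_congr rfl (fun hvM => ?_) fun _ => rfl
    obtain ⟨p1, -⟩ := hp _ hvM
    rw [hs4, b1 _ hvM, hs3, k2 _ (hL v hv), base2]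
    simp only [hRdef, reps, Finset.mem_filter] at p1
    -- The start `A` of the superblock is a multiple of `2 ^ (4 * k)` and the partner lies less than
    -- `2 ^ (4 * k)` beyond it, so `A` plus the computed low bits is the partner itself.
    have e1 : a = A + a % 2 ^ (4 * k) := by
      have := Nat.mod_le a (2 ^ (4 * k)); omega
    have e2 : A = 2 ^ (4 * k) * (a / 2 ^ (4 * k)) := by
      have := Nat.div_add_mod a (2 ^ (4 * k)); omega
    have e3 := Nat.mod_lt a (show 0 < 2 ^ (4 * k) by positivity)
    obtain ⟨d, hd⟩ := Nat.exists_eq_add_of_le p1.2.2.1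
    have e4 : p (L v) % 2 ^ (4 * k) = d := by
      rw [hd, e2, Nat.mul_add_mod, Nat.mod_eq_of_lt (by omega)]
    rw [e4, ← hd]
  · rw [c0, c1, c2, c3, wc, b2]
    simp [weighCost]

end RankQuery

/-! ### Merging blocks into superblocks, and the amortised cost -/

namespace RankQuery
open Cmd

section labels
variable {α : Type*} (cls : ℕ → α) (n : ℕ)

/-- Every element is labelled by a representative of its class. -/
structure Labels (L : ℕ → ℕ) : Prop where
  lt : ∀ v < n, L v < n
  idem : ∀ v < n, L (L v) = L v
  cls_eq : ∀ v < n, cls (L v) = cls v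

/-- Representatives in a common interval `[i * b, (i + 1) * b)` lie in different classes. -/
def Separated (L : ℕ → ℕ) (b : ℕ) : Prop :=
  ∀ u < n, ∀ v < n, L u = u → L v = v → u / b = v / b → cls u = cls v → u = v

/-- Representatives in a common interval `[i * S, (i + 1) * S)` lie in different classes, if their
blocks of length `b` start below `t`. -/
def SeparatedBelow (L : ℕ → ℕ) (b S t : ℕ) : Prop :=
  ∀ u < n, ∀ v < n, L u = u → L v = v → u / b * b < t → v / b * b < t → u / S = v / S →
    cls u = cls v → u = v

variable {cls n}

theorem mem_reps {L : ℕ → ℕ} {lo hi v : ℕ} :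
    v ∈ reps L n lo hi ↔ v < n ∧ L v = v ∧ lo ≤ v ∧ v < hi := by
  simp [reps]

/-- The effect of merging the block `[t, t + b)`. -/
theorem merge_step [DecidableEq α] {L L' p : ℕ → ℕ} {M : Finset ℕ} {b S t : ℕ} (hb : 0 < b)
    (hbS : b ∣ S) (hbt : t % b = 0) (hL : Labels cls n L) (h1 : Separated cls n L b)
    (h2 : SeparatedBelow cls n L b S t)
    (hM : M = (reps L n t (t + b)).filter fun v =>
      cls v ∈ (reps L n (t - t % S) t).image cls)
    (hp : ∀ v ∈ M, p v ∈ reps L n (t - t % S) t ∧ cls (p v) = cls v)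
    (hL' : ∀ v < n, L' v = if L v ∈ M then p (L v) else L v) :
    Labels cls n L' ∧ Separated cls n L' b ∧ SeparatedBelow cls n L' b S (t + 1) ∧
      (reps L' n 0 n).card + M.card = (reps L n 0 n).card := by
  obtain ⟨j, hj⟩ : b ∣ t := Nat.dvd_of_mod_eq_zero hbt
  have hMrep : ∀ v ∈ M, v < n ∧ L v = v ∧ t ≤ v ∧ v < t + b := fun v hv => by
    rw [hM, Finset.mem_filter] at hv
    exact mem_reps.1 hv.1
  -- Exactly the members of `M` stop being representatives: they lie at or above `t`, their partners
  -- below `t`, so no partner is itself relabelled.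
  have hrep : ∀ v < n, L' v = v ↔ L v = v ∧ v ∉ M := by
    intro v hv
    rw [hL' v hv]
    split_ifs with hvM
    · have h3 := mem_reps.1 (hp _ hvM).1
      have h4 := hMrep _ hvM
      constructor
      · intro h5
        rw [h5] at h3
        rw [h3.2.1] at h4
        omega
      · rintro ⟨h5, h6⟩
        rw [h5] at hvM
        exact absurd hvM h6
    · constructor
      · intro h5
        exact ⟨h5, by rwa [h5] at hvM⟩
      · exact fun h5 => h5.1
  have hsep : Separated cls n L' b := fun u hu v hv hu' hv' =>
    h1 u hu v hv ((hrep u hu).1 hu').1 ((hrep v hv).1 hv').1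
  refine ⟨⟨?_, ?_, ?_⟩, hsep, ?_, ?_⟩
  · intro v hv
    rw [hL' v hv]
    split_ifs with hvM
    · exact (mem_reps.1 (hp _ hvM).1).1
    · exact hL.lt v hv
  · intro v hv
    rw [hL' v hv]
    split_ifs with hvM
    · have h3 := mem_reps.1 (hp _ hvM).1
      refine (hrep _ h3.1).2 ⟨h3.2.1, fun h => ?_⟩
      have := hMrep _ h
      omega
    · exact (hrep _ (hL.lt v hv)).2 ⟨hL.idem v hv, hvM⟩
  · intro v hv
    rw [hL' v hv]
    split_ifs with hvM
    · rw [(hp _ hvM).2, hL.cls_eq v hv]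
    · exact hL.cls_eq v hv
  · -- an element of the block with a partner before the block is not a representative any more
    have key : ∀ u < n, ∀ v < n, L' u = u → L' v = v → u / b * b < t → v / b * b = t →
        u / S = v / S → cls u = cls v → False := by
      intro u hu v hv hu' hv' hut hvt hS hcls
      obtain ⟨hu1, -⟩ := (hrep u hu).1 hu'
      obtain ⟨hv1, hv2⟩ := (hrep v hv).1 hv'
      apply hv2
      have hvj : v / b = j := by
        rw [hj, mul_comm] at hvt; exact Nat.eq_of_mul_eq_mul_left hb hvt
      have huj : u / b < j := by
        rw [hj, mul_comm] at hut; exact lt_of_mul_lt_mul_left hut (Nat.zero_le b)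
      have d1 := Nat.div_add_mod v b
      have d2 := Nat.mod_lt v hb
      rw [hvj, ← hj] at d1
      have hut' : u < t := by
        rw [Nat.div_lt_iff_lt_mul hb, mul_comm, ← hj] at huj; exact huj
      have htS : t / S = v / S := by
        obtain ⟨c, rfl⟩ := hbS
        rw [← Nat.div_div_eq_div_mul, ← Nat.div_div_eq_div_mul, hvj, hj,
          Nat.mul_div_cancel_left _ hb]
      have hlow : t - t % S ≤ u := by
        have e1 := Nat.div_add_mod t S
        have e2 := Nat.div_add_mod u S
        rw [hS, ← htS] at e2
        omega
      rw [hM, Finset.mem_filter, mem_reps, Finset.mem_image]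
      exact ⟨⟨hv, hv1, by omega, by omega⟩, u, mem_reps.2 ⟨hu, hu1, hlow, hut'⟩, hcls⟩
    intro u hu v hv hu' hv' hut hvt hS hcls
    rcases Nat.lt_succ_iff_lt_or_eq.1 hut with hu1 | hu1
    · rcases Nat.lt_succ_iff_lt_or_eq.1 hvt with hv1 | hv1
      · exact h2 u hu v hv ((hrep u hu).1 hu').1 ((hrep v hv).1 hv').1 hu1 hv1 hS hcls
      · exact (key u hu v hv hu' hv' hu1 hv1 hS hcls).elim
    · rcases Nat.lt_succ_iff_lt_or_eq.1 hvt with hv1 | hv1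
      · exact (key v hv u hu hv' hu' hv1 hu1 hS.symm hcls.symm).elim
      · exact hsep u hu v hv hu' hv' (Nat.eq_of_mul_eq_mul_right hb (hu1.trans hv1.symm)) hcls
  · have : reps L' n 0 n = reps L n 0 n \ M := by
      ext v
      simp only [mem_reps, Finset.mem_sdiff]
      constructor
      · rintro ⟨h3, h4, -⟩
        obtain ⟨h5, h6⟩ := (hrep v h3).1 h4
        exact ⟨⟨h3, h5, Nat.zero_le _, h3⟩, h6⟩
      · rintro ⟨⟨h3, h4, -⟩, h5⟩
        exact ⟨h3, (hrep v h3).2 ⟨h4, h5⟩, Nat.zero_le _, h3⟩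
    rw [this]
    refine Finset.card_sdiff_add_card_eq_card fun v hv => ?_
    obtain ⟨h3, h4, -⟩ := hMrep v hv
    exact mem_reps.2 ⟨h3, h4, Nat.zero_le _, h3⟩

theorem injOn_block {L : ℕ → ℕ} {b t : ℕ} (hb : 0 < b) (hbt : t % b = 0)
    (h : Separated cls n L b) : Set.InjOn cls (reps L n t (t + b)) := by
  obtain ⟨j, rfl⟩ := Nat.dvd_of_mod_eq_zero hbt
  have hdiv : ∀ v, b * j ≤ v → v < b * j + b → v / b = j := by
    intro v h1 h2
    obtain ⟨d, rfl⟩ := Nat.exists_eq_add_of_le h1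
    rw [Nat.mul_add_div hb, Nat.div_eq_of_lt (by omega), add_zero]
  intro u hu v hv huv
  obtain ⟨u1, u2, u3, u4⟩ := mem_reps.1 hu
  obtain ⟨v1, v2, v3, v4⟩ := mem_reps.1 hv
  exact h u u1 v v1 u2 v2 (by rw [hdiv u u3 u4, hdiv v v3 v4]) huv

/-- Everything from the start of the superblock of `t` up to `t` shares one superblock and lies in
blocks that start below `t`. -/
theorem injOn_below {L : ℕ → ℕ} {b S t : ℕ} (hS : 0 < S)
    (h : SeparatedBelow cls n L b S t) : Set.InjOn cls (reps L n (t - t % S) t) := by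
  have hdiv : ∀ v, t - t % S ≤ v → v < t → v / S = t / S := by
    intro v h1 h2
    refine le_antisymm (Nat.div_le_div_right h2.le) ?_
    rw [Nat.le_div_iff_mul_le hS, mul_comm]
    have := Nat.div_add_mod t S
    omega
  intro u hu v hv huv
  obtain ⟨u1, u2, u3, u4⟩ := mem_reps.1 hu
  obtain ⟨v1, v2, v3, v4⟩ := mem_reps.1 hv
  exact h u u1 v v1 u2 v2 ((Nat.div_mul_le_self u b).trans_lt u4)
    ((Nat.div_mul_le_self v b).trans_lt v4) (by rw [hdiv u u3 u4, hdiv v v3 v4]) huv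

theorem card_reps_le (L : ℕ → ℕ) (t b : ℕ) : (reps L n t (t + b)).card ≤ b := by
  have : reps L n t (t + b) ⊆ Finset.Ico t (t + b) := fun v hv => by
    have := mem_reps.1 hv
    simp; omega
  simpa using Finset.card_le_card this

end labels

/-- The rounded-up number of chunks times the chunk size `k * 2 ^ (k - 1)` exceeds `m` by less than
one chunk. Both sides carry a factor `k` to avoid fractions: the cost is 4/k per coin, plus one
superfluous chunk. -/
theorem mul_weighCost_le {k : ℕ} (hk : 1 ≤ k) (m : ℕ) :
    k * weighCost k m ≤ 4 * m + 2 * (k * 2 ^ k) := by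
  have e : k * 2 ^ k = 2 * (k * 2 ^ (k - 1)) := by
    obtain ⟨j, rfl⟩ := Nat.exists_eq_add_of_le' hk
    rw [Nat.add_sub_cancel, pow_succ]; ring
  have h := Nat.div_mul_le_self (m + k * 2 ^ (k - 1) - 1) (k * 2 ^ (k - 1))
  calc k * weighCost k m
      = 2 * (k * 2 ^ k) * ((m + k * 2 ^ (k - 1) - 1) / (k * 2 ^ (k - 1))) := by
        unfold weighCost; ring
    _ = 4 * ((m + k * 2 ^ (k - 1) - 1) / (k * 2 ^ (k - 1)) * (k * 2 ^ (k - 1))) := by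
        rw [e]; ring
    _ ≤ 4 * m + 2 * (k * 2 ^ k) := by omega

/-- The 24 is 4 + 4 + 16: weighing the coins of the block, the rounding in that weighing, and the
rounding in the `4 * k` weighings for the bits. Both roundings are absorbed by `hkb`. -/
theorem mul_mergeCost_le {k b c m : ℕ} (hk : 1 ≤ k) (hkb : k * (k * 2 ^ k) ≤ 2 * b)
    (hc : c ≤ b) :
    k * (weighCost k c + weighCost k m * (4 * k)) ≤ 16 * k * m + 24 * b := by
  have h1 := mul_weighCost_le hk c
  have h2 := Nat.mul_le_mul_left (4 * k) (mul_weighCost_le hk m)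
  have h3 : k * 2 ^ k ≤ k * (k * 2 ^ k) := Nat.le_mul_of_pos_left _ hk
  calc k * (weighCost k c + weighCost k m * (4 * k))
      = k * weighCost k c + 4 * k * (k * weighCost k m) := by ring
    _ ≤ (4 * c + 2 * (k * 2 ^ k)) + 4 * k * (4 * m + 2 * (k * 2 ^ k)) := by omega
    _ = 4 * c + 2 * (k * 2 ^ k) + 16 * k * m + 8 * (k * (k * 2 ^ k)) := by ring
    _ ≤ _ := by omega

variable {n : ℕ} (o : Finset (Fin n) → ℕ) {k : ℕ} {s : Store}

def blockBody : Cmd := .ite ((Expr.reg rPos % .reg rBlock).eq 0) mergeCmd .skip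

/-- Merge the blocks within each superblock. -/
def blocksCmd : Cmd := .loop rPos rN blockBody

variable {α : Type*} [DecidableEq α] {cls : ℕ → α}
  (ho : ∀ (s : Store) (a : ℕ), o (s.set n a) = ((s.supp n a).image cls).card)

include ho in
theorem blocksCmd_spec (h : Env n k s) (hk : 1 ≤ k) (hk' : 4 * k ≤ 4 * n + 7)
    (hrows : 2 ^ k ≤ 4 * n + 8) (hbits : s.reg rBits = 4 * k)
    (hsuper : s.reg rSuper = 2 ^ (4 * k)) {b : ℕ} (hblock : s.reg rBlock = b) (hb : 0 < b)
    (hbS : b ∣ 2 ^ (4 * k)) (hbn : b ≤ n) (hkb : k * (k * 2 ^ k) ≤ 2 * b)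
    (hL : Labels cls n (s.arr aLabel)) (hsep : Separated cls n (s.arr aLabel) b) :
    Labels cls n ((blocksCmd.run o s).arr aLabel) ∧
    Separated cls n ((blocksCmd.run o s).arr aLabel) (2 ^ (4 * k)) ∧
    k * blocksCmd.cost o s + 16 * k * (reps ((blocksCmd.run o s).arr aLabel) n 0 n).card ≤
      16 * k * (reps (s.arr aLabel) n 0 n).card + 48 * n := by
  obtain ⟨st, hst, hI1, -, hI3, hI4⟩ := loop_rule_cost o (x := rPos) (y := rN) (c := blockBody)
    (s := s) (b := n) h.size (by rw [h.limit]; omega)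
    -- The number of representatives acts as a potential that pays for the bits of the partners. The
    -- factor `b * ((i + b - 1) / b)` is the total length of the blocks that start below `i`.
    (fun i st q => Labels cls n (st.arr aLabel) ∧ Separated cls n (st.arr aLabel) b ∧
      SeparatedBelow cls n (st.arr aLabel) b (2 ^ (4 * k)) i ∧
      k * q + 16 * k * (reps (st.arr aLabel) n 0 n).card ≤
        16 * k * (reps (s.arr aLabel) n 0 n).card + 24 * (b * ((i + b - 1) / b)))
    ⟨hL, hsep, fun u hu v hv _ _ h => absurd h (Nat.not_lt_zero _), by simp⟩
    (by
      rintro i st q hi hz ha ⟨i1, i2, i3, i4⟩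
      have hE : Env n k (st.setReg rPos i) :=
        (h.frame hz ha (by decide) (by decide) (by decide)).setReg i (by decide)
      have e1 := (hz rBlock rfl (by decide)).trans hblock
      have e2 := (hz rBits rfl (by decide)).trans hbits
      have e3 := (hz rSuper rfl (by decide)).trans hsuper
      simp only [blockBody, run_ite, run_skip, cost_ite, Expr.eval_eq, Expr.eval_mod,
        Expr.eval_reg, Store.setReg_reg, Nat.reduceEqDiff, if_true, if_false, e1, Expr.eval_zero]
      by_cases hib : i % b = 0
      · simp only [hib, if_true, ne_eq, one_ne_zero, not_false_eq_true]
        obtain ⟨M, p, m1, m2, m3, m4⟩ := mergeCmd_spec o ho hE hk hk' hrows (by simpa using e2)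
          (by simpa using e3) (a := i) (b := b) (by simp) (by simpa using e1)
          (by simpa using i1.lt) (by simpa using injOn_block hb hib i2)
          (by simpa using injOn_below (by positivity) i3)
        simp only [Store.setReg_arr] at m1 m2 m3 m4
        obtain ⟨j1, j2, j3, j4⟩ := merge_step hb hbS hib i1 i2 i3 m1 m2 m3
        refine ⟨j1, j2, j3, ?_⟩
        have hcost := mul_mergeCost_le (m := M.card) hk hkb (card_reps_le (n := n) (st.arr aLabel) i b)
        rw [← m4] at hcost
        have hdiv : (i + 1 + b - 1) / b = (i + b - 1) / b + 1 := by
          obtain ⟨j, rfl⟩ := Nat.dvd_of_mod_eq_zero hib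
          rw [show b * j + 1 + b - 1 = b * j + b by omega,
            show b * j + b - 1 = b * j + (b - 1) by omega, Nat.mul_add_div hb,
            Nat.mul_add_div hb, Nat.div_self hb, Nat.div_eq_of_lt (show b - 1 < b by omega)]
        rw [hdiv, mul_add, mul_add, mul_one]
        rw [← j4, mul_add] at i4
        omega
      · simp only [hib, if_false, ne_eq, not_true_eq_false, Store.setReg_arr]
        -- No block starts at `i`, so "below `i + 1`" and "below `i`" mean the same for starts of
        -- blocks.
        refine ⟨i1, i2, fun u hu v hv hu' hv' hut hvt => ?_, ?_⟩
        · have ne : ∀ w, w / b * b ≠ i := fun w h => hib (by rw [← h]; simp)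
          exact i3 u hu v hv hu' hv' (by have := ne u; omega) (by have := ne v; omega)
        · refine i4.trans ?_
          have : (i + b - 1) / b ≤ (i + 1 + b - 1) / b := Nat.div_le_div_right (by omega)
          have := Nat.mul_le_mul_left b this
          simpa [cost] using this)
  rw [blocksCmd, hst, Store.setReg_arr]
  refine ⟨hI1, fun u hu v hv hu' hv' => hI3 u hu v hv hu' hv'
    ((Nat.div_mul_le_self u b).trans_lt hu) ((Nat.div_mul_le_self v b).trans_lt hv),
    hI4.trans ?_⟩
  -- The blocks cover less than `n + b ≤ 2 * n` positions, which turns 24 into 48.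
  have := Nat.mul_div_le (n + b - 1) b
  omega

end RankQuery

/-! ### The rounds of the algorithm and the final count -/

namespace RankQuery
open Cmd

variable {n : ℕ} (o : Finset (Fin n) → ℕ) {k : ℕ} {s : Store}

def powBody : Cmd :=
  .seq (.store aPow (.reg rLow) (.reg rTemp)) (.assign rTemp (.reg rTemp + .reg rTemp))

/-- Tabulate the powers of two. -/
def powCmd : Cmd := .seq (.assign rTemp 1) (.loop rLow rLimit powBody)

theorem powCmd_spec {N : ℕ} (h : s.reg rLimit = N) :
    ∀ j < N, (powCmd.run o s).arr aPow j = 2 ^ j := by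
  obtain ⟨st, hst, -, hI⟩ := loop_rule o (x := rLow) (y := rLimit) (c := powBody)
    (s := s.setReg rTemp 1) (b := N) (by simpa using h) (by simp [h])
    (fun i st => st.reg rTemp = 2 ^ i ∧ ∀ j < i, st.arr aPow j = 2 ^ j)
    (by simp)
    (by
      rintro i st hi hz ha ⟨h1, h2⟩
      simp only [powBody, run_seq, run_store, run_assign]
      refine ⟨by simp [h1, pow_succ, mul_two], fun j hj => ?_⟩
      by_cases hji : j = i
      · simp [hji, h1]
      · simpa [hji] using h2 j (by omega))
  intro j hj
  simp only [powCmd, run_seq, run_assign, Expr.eval_one]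
  rw [hst, Store.setReg_arr]
  exact hI j hj

def labelCmd : Cmd := .loop rElt rN (.store aLabel (.reg rElt) (.reg rElt))

theorem labelCmd_spec (hn : s.reg rN = n) (hl : n ≤ s.reg rLimit) :
    ∀ v < n, (labelCmd.run o s).arr aLabel v = v := by
  intro v hv
  rw [labelCmd, loop_fill o hn hl aLabel (fun v => v) (by simp), if_pos hv]

/-- The product of `rDim` and `rHalf`, by repeated addition. -/
def capCmd : Cmd :=
  .seq (.assign rCap 0) (.loop rLow rDim (.assign rCap (.reg rCap + .reg rHalf)))

theorem capCmd_spec {h : ℕ} (hd : s.reg rDim = k) (hk : k ≤ s.reg rLimit) (hh : s.reg rHalf = h) :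
    (capCmd.run o s).reg rCap = k * h := by
  obtain ⟨st, hst, hI⟩ := loop_rule o (x := rLow) (y := rDim)
    (c := .assign rCap (.reg rCap + .reg rHalf))
    (s := s.setReg rCap 0) (b := k) (by simpa using hd) (by simpa using hk)
    (fun i st => st.reg rCap = i * h)
    (by simp)
    (by
      intro i st hi hz ha h1
      have e1 := hz rHalf rfl (by decide)
      simp at e1
      simp [h1, e1, hh, add_one_mul])
  simp only [capCmd, run_seq, run_assign, Expr.eval_zero, hst]
  simpa using hI

/-- Set the parameters of the weighing program for the dimension `rDim`. -/
def setupCmd : Cmd :=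
  .seq (.assign rRows (entry aPow rDim))
  (.seq (.assign rHalf (.get aPow (.reg rDim - 1)))
  (.seq (.assign rBits (.reg rDim + .reg rDim + .reg rDim + .reg rDim))
  (.seq (.assign rSuper (entry aPow rBits)) capCmd)))

theorem setupCmd_spec (hn : s.reg rN = n) (hl : s.reg rLimit = 4 * n + 8) (hd : s.reg rDim = k)
    (hk : 4 * k ≤ 4 * n + 7) (hp : ∀ j < 4 * n + 8, s.arr aPow j = 2 ^ j) :
    Env n k (setupCmd.run o s) ∧ (setupCmd.run o s).reg rBits = 4 * k ∧
      (setupCmd.run o s).reg rSuper = 2 ^ (4 * k) := by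
  have e0 : k + k + k + k = 4 * k := by ring
  have p1 := hp k (by omega)
  have p2 := hp (k - 1) (by omega)
  have p3 := hp (4 * k) (by omega)
  simp only [setupCmd, run_seq, run_assign]
  simp only [eval_entry, Expr.eval_get, Expr.eval_sub, Expr.eval_add, Expr.eval_reg,
    Expr.eval_one, Store.setReg_reg, Store.setReg_arr, Nat.reduceEqDiff, if_true, if_false, hd,
    e0, p1, p2, p3]
  refine ⟨⟨?_, ?_, ?_, ?_, ?_, ?_, ?_⟩, ?_, ?_⟩
  · rw [run_reg o (by rfl)]; simpa using hn
  · rw [run_reg o (by rfl)]; simpa using hl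
  · rw [run_reg o (by rfl)]; simpa using hd
  · rw [run_reg o (by rfl)]; simp
  · rw [run_reg o (by rfl)]; simp
  · exact capCmd_spec o (by simpa using hd) (by simp [hl]; omega) (by simp)
  · rw [run_arr o (by rfl)]; simpa using hp
  · rw [run_reg o (by rfl)]; simp
  · rw [run_reg o (by rfl)]; simp

/-- One round: merge the blocks within each superblock; the superblocks are the next blocks. -/
def roundCmd : Cmd :=
  .seq setupCmd
  (.seq blocksCmd
  (.seq (.assign rDim (.reg rDim + .reg rDim)) (.assign rBlock (.reg rSuper))))

def roundsBody : Cmd := .ite ((Expr.reg rBlock).lt (.reg rN)) roundCmd .skip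

def learnCmd : Cmd :=
  .seq powCmd
  (.seq labelCmd
  (.seq (.assign rDim 1)
  (.seq (.assign rBlock 1) (.loop rRound rN roundsBody))))

variable {α : Type*} [DecidableEq α] {cls : ℕ → α}
  (ho : ∀ (s : Store) (a : ℕ), o (s.set n a) = ((s.supp n a).image cls).card)

/-- The invariant of the main loop, after `q` queries. -/
structure Learning (cls : ℕ → α) (n k b q : ℕ) (s : Store) : Prop where
  pow : ∀ j < 4 * n + 8, s.arr aPow j = 2 ^ j
  dim : s.reg rDim = k
  block : s.reg rBlock = b
  dim_pos : 1 ≤ k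
  dim_le : k * (k * 2 ^ k) ≤ 2 * b
  block_eq : ∃ e < 4 * k, b = 2 ^ e
  labels : Labels cls n (s.arr aLabel)
  separated : Separated cls n (s.arr aLabel) b
  queries : k * q + 16 * k * (reps (s.arr aLabel) n 0 n).card + 96 * n ≤ 112 * (k * n)

-- Divided by `k`, the invariant `queries` says q + 16 · (number of representatives) + 96n/k ≤ 112n.
-- A round raises the first two terms together by at most 48n/k, which is what the third loses when
-- `k` doubles.
include ho in
theorem roundCmd_spec {b q : ℕ} (h : Learning cls n k b q s) (hn : s.reg rN = n)
    (hl : s.reg rLimit = 4 * n + 8) (hb : b < n) :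
    Learning cls n (k + k) (2 ^ (4 * k)) (q + roundCmd.cost o s) (roundCmd.run o s) := by
  obtain ⟨e, he, rfl⟩ := h.block_eq
  have hk := h.dim_pos
  have hkb := h.dim_le
  have two_le : 2 ≤ 2 ^ k := by simpa using Nat.pow_le_pow_right (show 0 < 2 by norm_num) hk
  have hrows : 2 ^ k ≤ k * (k * 2 ^ k) :=
    (Nat.le_mul_of_pos_left _ hk).trans (Nat.le_mul_of_pos_left _ hk)
  -- Together with `hkb` this yields `k ≤ b < n`; hence `4 * k` stays within the loop limit and the
  -- table of powers.
  have hkn : k * 2 ≤ k * (k * 2 ^ k) :=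
    Nat.mul_le_mul_left k (two_le.trans (Nat.le_mul_of_pos_left _ hk))
  have hk' : 4 * k ≤ 4 * n + 7 := by omega
  obtain ⟨s1, s2, s3⟩ := setupCmd_spec o hn hl h.dim hk' h.pow
  have f1 := run_arr o (c := setupCmd) (a := aLabel) rfl s
  have f2 := run_reg o (c := setupCmd) (z := rBlock) rfl s
  have c1 : setupCmd.cost o s = 0 := cost_eq_zero o rfl _
  obtain ⟨b1, b2, b3⟩ := blocksCmd_spec o ho s1 hk hk' (by omega) s2 s3 (f2.trans h.block)
    (by positivity) (pow_dvd_pow 2 he.le) hb.le hkb (by rw [f1]; exact h.labels)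
    (by rw [f1]; exact h.separated)
  have g1 : Env n k (blocksCmd.run o (setupCmd.run o s)) := s1.run o (by decide) (by decide)
  have g2 : (blocksCmd.run o (setupCmd.run o s)).reg rSuper = 2 ^ (4 * k) := by
    rw [run_reg o (by rfl), s3]
  have c2 : roundCmd.cost o s = blocksCmd.cost o (setupCmd.run o s) := by
    simp [roundCmd, c1, cost]
  rw [← c2, f1] at b3
  refine ⟨?_, ?_, ?_, by omega, ?_, ⟨4 * k, by omega, rfl⟩, ?_, ?_, ?_⟩
  · simpa [roundCmd] using g1.pow
  · simp [roundCmd, g1.dim]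
  · simp [roundCmd, g2]
  · have h2k : k < 2 ^ k := Nat.lt_two_pow_self
    have h3 : 2 * k ≤ 2 ^ k := by
      obtain ⟨j, rfl⟩ := Nat.exists_eq_add_of_le' hk
      have : j < 2 ^ j := Nat.lt_two_pow_self
      rw [pow_succ]; omega
    calc (k + k) * ((k + k) * 2 ^ (k + k))
        = (2 * k) * (2 * k) * (2 ^ k * 2 ^ k) := by rw [pow_add]; ring
      _ ≤ 2 ^ k * 2 ^ k * (2 ^ k * 2 ^ k) := by gcongr
      _ = 2 ^ (4 * k) := by rw [← pow_add, ← pow_add]; congr 1; ring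
      _ ≤ 2 * 2 ^ (4 * k) := by omega
  · simpa [roundCmd] using b1
  · simpa [roundCmd] using b2
  · have hq := h.queries
    have e1 : (roundCmd.run o s).arr aLabel = (blocksCmd.run o (setupCmd.run o s)).arr aLabel := by
      simp [roundCmd]
    rw [e1]
    generalize (reps ((blocksCmd.run o (setupCmd.run o s)).arr aLabel) n 0 n).card = r' at *
    generalize (reps (s.arr aLabel) n 0 n).card = r at *
    nlinarith

-- Once the block length reaches `n`, the whole universe is a single block, so each class has only
-- one representative and equal labels mean equal classes.
include ho in
theorem learnCmd_spec (hn : s.reg rN = n) (hl : s.reg rLimit = 4 * n + 8) :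
    (∀ u < n, ∀ v < n, (learnCmd.run o s).arr aLabel u = (learnCmd.run o s).arr aLabel v ↔
      cls u = cls v) ∧ learnCmd.cost o s ≤ 112 * n := by
  have p := powCmd_spec o hl
  have n1 : (powCmd.run o s).reg rN = n := by rw [run_reg o (by rfl), hn]
  have l1 : (powCmd.run o s).reg rLimit = 4 * n + 8 := by rw [run_reg o (by rfl), hl]
  have l := labelCmd_spec o n1 (by omega)
  have p2 : (labelCmd.run o (powCmd.run o s)).arr aPow = (powCmd.run o s).arr aPow :=
    run_arr o (by rfl) _
  have n2 : (labelCmd.run o (powCmd.run o s)).reg rN = n := by rw [run_reg o (by rfl), n1]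
  have l2 : (labelCmd.run o (powCmd.run o s)).reg rLimit = 4 * n + 8 := by
    rw [run_reg o (by rfl), l1]
  have c1 : powCmd.cost o s = 0 := cost_eq_zero o rfl _
  have c2 : labelCmd.cost o (powCmd.run o s) = 0 := cost_eq_zero o rfl _
  have c3 : ∀ x e s, (Cmd.assign x e).cost o s = 0 := fun _ _ _ => rfl
  simp only [learnCmd, run_seq, run_assign, cost_seq, c1, c2, c3, zero_add, Expr.eval_one]
  rw [← p2] at p
  generalize labelCmd.run o (powCmd.run o s) = s1 at *
  have hlab : Labels cls n (s1.arr aLabel) := ⟨fun v hv => by rw [l v hv]; exact hv,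
    fun v hv => by rw [l v hv, l v hv], fun v hv => by rw [l v hv]⟩
  obtain ⟨st, hst, ⟨k, b, hlb, hI⟩⟩ := loop_rule_cost o (x := rRound) (y := rN) (c := roundsBody)
    (s := (s1.setReg rDim 1).setReg rBlock 1) (b := n) (by simpa using n2) (by simp [l2]; omega)
    -- The block length strictly increases in every round in which it is below `n`, so `n` rounds
    -- are enough; later rounds do nothing.
    (fun i st q => ∃ k b, (n ≤ b ∨ i < b) ∧ Learning cls n k b q st)
    (by
      -- Initially `k = b = 1` and all elements are representatives; the query invariant is then 16n
      -- + 96n ≤ 112n.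
      refine ⟨1, 1, by omega, by simpa using p, by simp, by simp, le_rfl, by norm_num,
        ⟨0, by norm_num, rfl⟩, by simpa using hlab, ?_, ?_⟩
      · intro u hu v hv _ _ huv _
        simpa using huv
      · have := card_reps_le (n := n) (s1.arr aLabel) 0 n
        simp at this ⊢
        omega)
    (by
      rintro i st q hi hz ha ⟨k, b, hb, hI⟩
      have e1 : (st.setReg rRound i).reg rN = n := by
        have := hz rN rfl (by decide)
        simp at this ⊢; rw [this, n2]
      have e2 : (st.setReg rRound i).reg rLimit = 4 * n + 8 := by
        have := hz rLimit rfl (by decide)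
        simp at this ⊢; rw [this, l2]
      have hI' : Learning cls n k b q (st.setReg rRound i) :=
        ⟨hI.pow, by simpa using hI.dim, by simpa using hI.block, hI.dim_pos, hI.dim_le,
          hI.block_eq, hI.labels, hI.separated, hI.queries⟩
      simp only [roundsBody, run_ite, cost_ite, Expr.eval_lt, Expr.eval_reg, e1, hI'.block,
        run_skip]
      by_cases hbn : b < n
      · simp only [hbn, if_true, ne_eq, one_ne_zero, not_false_eq_true]
        refine ⟨k + k, 2 ^ (4 * k), Or.inr ?_, roundCmd_spec o ho hI' e1 e2 hbn⟩
        obtain ⟨e, he, rfl⟩ := hI.block_eq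
        have : 2 ^ e < 2 ^ (4 * k) := Nat.pow_lt_pow_right (by norm_num) he
        omega
      · simp only [hbn, if_false, ne_eq, not_true_eq_false]
        exact ⟨k, b, Or.inl (by omega), hI'⟩)
  rw [hst, Store.setReg_arr]
  have hnb : n ≤ b := by omega
  constructor
  · intro u hu v hv
    constructor
    · intro h
      rw [← hI.labels.cls_eq u hu, h, hI.labels.cls_eq v hv]
    · intro h
      have h1 := hI.labels.lt u hu
      have h2 := hI.labels.lt v hv
      refine hI.separated _ h1 _ h2 (hI.labels.idem u hu) (hI.labels.idem v hv) ?_ ?_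
      · rw [Nat.div_eq_of_lt (by omega), Nat.div_eq_of_lt (by omega)]
      · rw [hI.labels.cls_eq u hu, hI.labels.cls_eq v hv, h]
  · refine Nat.le_of_mul_le_mul_left ?_ hI.dim_pos
    have := hI.queries
    calc _ ≤ 112 * (k * n) := by omega
      _ = k * (112 * n) := by ring

/-- The part of an element of the universe. -/
def partOf (P : Finpartition (Finset.univ : Finset (Fin n))) (v : ℕ) : Finset (Fin n) :=
  if h : v < n then P.part ⟨v, h⟩ else ∅

/-- The hypothesis `ho` of the program's analysis, for the real oracle: the parts that a set meets
are the parts of its elements. -/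
theorem rank_set (P : Finpartition (Finset.univ : Finset (Fin n))) (s : Store) (a : ℕ) :
    rank P (s.set n a) = ((s.supp n a).image (partOf P)).card := by
  have h1 : ∀ p : Finset (Fin n), min (s.set n a ∩ p).card 1 =
      if (s.set n a ∩ p).Nonempty then 1 else 0 := by
    intro p
    split_ifs with h
    · have := h.card_pos; omega
    · simp [Finset.not_nonempty_iff_eq_empty.1 h]
  rw [rank, Finset.sum_congr rfl fun p _ => h1 p, ← Finset.card_filter]
  congr 1
  ext p
  simp only [Finset.mem_filter, Finset.mem_image, mem_supp]
  constructor
  · rintro ⟨hp, v, hv⟩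
    simp only [Store.set, Finset.mem_inter, Finset.mem_filter, Finset.mem_univ, true_and] at hv
    exact ⟨v, ⟨v.2, hv.1⟩, by simpa [partOf] using P.part_eq_of_mem hp hv.2⟩
  · rintro ⟨v, ⟨hv, hva⟩, rfl⟩
    simp only [partOf, hv, dif_pos]
    exact ⟨P.part_mem.2 (Finset.mem_univ _), ⟨v, hv⟩, by
      simp [Store.set, hva]⟩

end RankQuery

/-- A single oracle program learns every partition of every finite universe `{0, …, n - 1}` with
at most `C * n` rank queries and in polynomially many steps. -/
theorem theorem1 :
    ∃ (prog : RankQuery.Prog) (C : ℕ) (T : Polynomial ℕ),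
      ∀ (n : ℕ) (P : Finpartition (Finset.univ : Finset (Fin n))),
        ∃ (t q : ℕ) (s : RankQuery.Store),
          RankQuery.Exec (RankQuery.rank P) prog (RankQuery.Store.init n) t q s ∧
          RankQuery.Describes s P ∧
          q ≤ C * n ∧
          t ≤ T.eval n := by
  open RankQuery in
  let e : Expr := .reg rN + .reg rN + .reg rN + .reg rN + 8
  refine ⟨.seq (.assign rLimit e) learnCmd.prog, 112, (e.cost + 1 : ℕ) + learnCmd.time, ?_⟩
  intro n P
  have he : e.eval (Store.init n) = 4 * n + 8 := by
    simp [e, Store.init]; ring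
  have h1 : ((Store.init n).setReg rLimit (e.eval (Store.init n))).reg rLimit = 4 * n + 8 := by
    simp [he]
  obtain ⟨h2, h3⟩ := learnCmd_spec (rank P) (rank_set P)
    (s := (Store.init n).setReg rLimit (e.eval (Store.init n))) (by simp [Store.init]) h1
  -- The conditions on protected registers are syntactic, so evaluation checks them for the whole
  -- program.
  obtain ⟨t, ht, ex⟩ := Cmd.exec (rank P) (c := learnCmd) (by decide) (by decide) h1
  refine ⟨_, _, _, .seq (.assign _ _ _) ex, fun u v => ?_, by simpa using h3, by simpa using ht⟩
  rw [h2 u u.2 v v.2]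
  simp only [partOf, u.2, v.2, dif_pos]
  constructor
  · intro h
    exact ⟨P.part u, P.part_mem.2 (Finset.mem_univ _), P.mem_part (Finset.mem_univ _),
      by rw [h]; exact P.mem_part (Finset.mem_univ _)⟩
  · rintro ⟨p, hp, hu, hv⟩
    rw [P.part_eq_of_mem hp hu, P.part_eq_of_mem hp hv]
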